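/- Let $G=(N,E)$ be a finite simple graph. For $I\subseteq N$ put $H_I=\ker\sum_{i\in I}x_i\subseteq\mathbb{Q}^N$, where $(x_i)_{i\in N}$ are the coordinate forms. The connected subgraph arrangement of $G$ is $$\mathcal{A}_G=\{H_I \mid \emptyset\neq I\subseteq N,\ G[I]\text{ is connected}\}.$$ A partition $\pi=(\pi_1,\dots,\pi_s)$ of a hyperplane arrangement $\mathcal{A}$ in a vector space $V$ into nonempty blocks is called nice if (i) any hyperplanes $H_1\in\pi_1,\dots,H_s\in\pi_s$ are linearly independent (that is, linear forms defining them are linearly independent), and (ii) for every intersection $X\neq V$ of members of $\mathcal{A}$, some set $\{H\in\pi_i\mid X\subseteq H\}$, $1\le i\le s$, has exactly one element. The arrangement $\mathcal{A}$ is factored if it admits a nice partition. For $n\ge 2$ let $\Delta_{n,1}$ be the graph on $\{1,\dots,n+1\}$ with edges $\{a,a+1\}$ for $1\le a<n$, together with $\{1,n+1\}$ and $\{2,n+1\}$. **Theorem.** (1) Let $G$ be a connected finite graph. Then $\mathcal{A}_G$ is factored if and only if $G$ is isomorphic to a path graph or to $\Delta_{n,1}$ for some $n\ge 2$. (2) For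 every $n\ge 2$ the following sets $\pi_1,\dots,\pi_{n+1}$ form a nice partition of $\mathcal{A}_{\Delta_{n,1}}$: $$\pi_1=\{H_{\{1,n+1\}}\},\qquad \pi_2=\{H_{\{n+1\}},H_{\{1\}},H_{\{1,2\}},\dots,H_{\{1,2,\dots,n\}}\},$$ $$\pi_i=\{H_I\in\mathcal{A}_{\Delta_{n,1}}\mid I\cap\{i,\dots,n\}=\emptyset\}\setminus\bigcup_{j=1}^{i-1}\pi_j\qquad(3\le i\le n+1).$$ -/

import Mathlib

namespace HyperplaneArrangement

variable {F : Type*} [Field F] {V : Type*} [AddCommGroup V] [Module F V]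

/-- A (central) hyperplane arrangement in `V`: a finite set of linear hyperplanes of `V`. -/
structure IsArrangement (A : Set (Submodule F V)) : Prop where
  finite : A.Finite
  hyperplane : ∀ H ∈ A, IsCoatom H

/-- The intersection lattice `L(A)`: all intersections of members of `A`; the empty intersection
is `V = ⊤`. -/
def intersectionLattice (A : Set (Submodule F V)) : Set (Submodule F V) :=
  {X | ∃ B ⊆ A, X = sInf B}

/-- The localization `A_X`: the members of `A` that contain `X`. -/
def localization (A : Set (Submodule F V)) (X : Submodule F V) : Set (Submodule F V) :=
  {H | H ∈ A ∧ X ≤ H}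

/-- The blocks of the induced partition `π_X` of `A_X`: the nonempty sets among
the `π i ∩ A_X`. -/
def inducedBlocks {ι : Type*} (A : Set (Submodule F V)) (π : ι → Set (Submodule F V))
    (X : Submodule F V) : Set (Set (Submodule F V)) :=
  {B | B.Nonempty ∧ ∃ i, B = π i ∩ localization A X}

/-- The indexed family `π` of blocks is a partition of `A`. -/
structure IsPartitionOf {ι : Type*} (A : Set (Submodule F V))
    (π : ι → Set (Submodule F V)) : Prop where
  nonempty : ∀ i, (π i).Nonempty
  disjoint : Pairwise fun i j => Disjoint (π i) (π j)
  union : ⋃ i, π i = A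

/-- `π` is independent: hyperplanes chosen one from each block are always linearly independent,
that is, linear forms defining them are linearly independent. -/
def IsIndependent {ι : Type*} (π : ι → Set (Submodule F V)) : Prop :=
  ∀ α : ι → Module.Dual F V, (∀ i, LinearMap.ker (α i) ∈ π i) → LinearIndependent F α

/-- `π` is a nice partition (a factorization) of the arrangement `A`. -/
structure IsNicePartition {ι : Type*} (A : Set (Submodule F V))
    (π : ι → Set (Submodule F V)) : Prop where
  partition : IsPartitionOf A π
  independent : IsIndependent π
  singleton : ∀ X ∈ intersectionLattice A, X ≠ ⊤ → ∃ B ∈ inducedBlocks A π X, ∃ H, B = {H}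

/-- `A` is factored: it admits a nice partition `(π_1, …, π_s)`. -/
def IsFactored (A : Set (Submodule F V)) : Prop :=
  ∃ (s : ℕ) (π : Fin s → Set (Submodule F V)), IsNicePartition A π

end HyperplaneArrangement

namespace ConnectedSubgraph

/-- The subspace `H_I = ker (∑_{i ∈ I} x_i)` of `F^N`. -/
def hyperplane (F : Type*) [Field F] {N : Type*} (I : Finset N) : Submodule F (N → F) :=
  LinearMap.ker (∑ i ∈ I, (LinearMap.proj i : (N → F) →ₗ[F] F))

/-- The connected subgraph arrangement `A_G(F)` in `F^N`: all `H_I`, where `I` is a nonempty set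
of vertices whose induced subgraph `G[I]` is connected. -/
def arrangement (F : Type*) [Field F] {N : Type*} (G : SimpleGraph N) :
    Set (Submodule F (N → F)) :=
  {H | ∃ I : Finset N, I.Nonempty ∧ (G.induce (I : Set N)).Connected ∧ H = hyperplane F I}

theorem arrangement_isArrangement (F : Type*) [Field F] {N : Type*} [Fintype N]
    (G : SimpleGraph N) : HyperplaneArrangement.IsArrangement (arrangement F G) := by
  classical
  constructor
  · refine (Set.finite_range (fun I : Finset N => hyperplane F I)).subset ?_
    rintro _ ⟨I, _, _, rfl⟩
    exact ⟨I, rfl⟩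
  · rintro _ ⟨I, ⟨i, hi⟩, _, rfl⟩
    refine LinearMap.isCoatom_ker_of_surjective ?_
    refine LinearMap.surjective_of_ne_zero fun h => ?_
    have := LinearMap.congr_fun h (Pi.single i 1)
    simp [LinearMap.sum_apply, Pi.single_apply, hi] at this

/-- The path-with-triangle graph `Δ_{n,k}`. The element `v` of `Fin (n + 1)` is the vertex with
label `v + 1` in `{1, …, n + 1}`. The edges are `{a, a + 1}` for `1 ≤ a < n`, together with
`{k, n + 1}` and `{k + 1, n + 1}`. -/
def pathWithTriangle (n k : ℕ) : SimpleGraph (Fin (n + 1)) :=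
  SimpleGraph.fromRel fun u v =>
    ((v : ℕ) + 1 = (u : ℕ) + 2 ∧ (v : ℕ) + 1 ≤ n) ∨
    ((v : ℕ) + 1 = n + 1 ∧ ((u : ℕ) + 1 = k ∨ (u : ℕ) + 1 = k + 1))

/-- A predicate on sets of vertices of `Δ_{n,1}`, for the block with label `b + 1`:
for label `1` the set is `{1, n + 1}`; for label `2` it is `{n + 1}` or one of the sets
`{1, …, m}` with `1 ≤ m ≤ n`; for label `i ≥ 3` it does not meet `{i, …, n}`. -/
def triangleBlockCondition (n : ℕ) (b : Fin (n + 1)) (I : Finset (Fin (n + 1))) : Prop :=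
  if (b : ℕ) + 1 = 1 then
    I = {0, Fin.last n}
  else if (b : ℕ) + 1 = 2 then
    I = {Fin.last n} ∨
      ∃ m : ℕ, 1 ≤ m ∧ m ≤ n ∧ I = Finset.univ.filter fun v : Fin (n + 1) => (v : ℕ) + 1 ≤ m
  else
    ∀ v ∈ I, ¬ ((b : ℕ) + 1 ≤ (v : ℕ) + 1 ∧ (v : ℕ) + 1 ≤ n)

/-- The hyperplanes `H_I` of the arrangement of `Δ_{n,1}` such that `I` satisfies the condition
for the block `b`. -/
def triangleCandidates (n : ℕ) (b : Fin (n + 1)) : Set (Submodule ℚ (Fin (n + 1) → ℚ)) :=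
  {H | ∃ I : Finset (Fin (n + 1)), I.Nonempty ∧
    ((pathWithTriangle n 1).induce (I : Set (Fin (n + 1)))).Connected ∧
    triangleBlockCondition n b I ∧ H = hyperplane ℚ I}

/-- The block `π_{b+1}` of the partition of the arrangement of `Δ_{n,1}`: the candidates for this
block which lie in no earlier block (equivalently, are no candidates for an earlier block). -/
def trianglePartition (n : ℕ) (b : Fin (n + 1)) : Set (Submodule ℚ (Fin (n + 1) → ℚ)) :=
  triangleCandidates n b \ ⋃ c : {c : Fin (n + 1) // c < b}, triangleCandidates n c

end ConnectedSubgraph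

namespace ConnectedSubgraph

open Finset HyperplaneArrangement

/-! For necessity, only flats of rank two are used. Two hyperplanes `H_P`, `H_Q` whose intersection
lies in no third member must lie in different blocks, since otherwise no block meets that flat in
exactly one hyperplane. If `P` and `Q` are disjoint with connected union, the relation `x_P + x_Q =
x_{P ∪ Q}` forces two of the three hyperplanes into one block, since otherwise a dependent choice
exists. Assigning blocks to connected sets is therefore a colouring with equality and inequality
constraints (`RankTwoColoring`). These constraints pass to induced minors
(`RankTwoColoring.contract`), and they are contradictory for five graphs: claw, 4-cycle, diamond,
`K₄` and bowtie.

A connected graph whose colouring exists is built by adding one vertex at a time, each stage being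
connected. A vertex attached to a path or to a `Δ_{n,1}` yields again such a graph or an induced
minor among the five (`attach_path_cases`, `attach_triangle_cases`,
`attach_pathWithTriangle_cases`). This gives `exists_labeling_of_rankTwoColoring`.

For sufficiency, pass to the partial sums `s_k` of the coordinates. For the path, the hyperplanes
become `s_j = s_i`, a braid arrangement, and the blocks collect equal `j`. For `Δ_{n,1}`, put `W =
-x_{n+1}`. The sets containing the apex give the equations `W = 0`, `s_j = W` and `s_j = s_1 + W`.
With the stated blocks, independence follows by solving for the `s_k` successively, and the
singleton condition by a case analysis on the coincidences among `0`, `s_1` and `W`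
(`exists_unique_mem_triangleBlocks`). As there are as many blocks as vertices, independence of forms
amounts to having no common nonzero root (`NiceBlocks.isNicePartition`). -/

/-- A finite set `S` is connected for the relation `r` if it is nonempty and every nonempty proper
subset of `S` is left by some pair of `r`. -/
def SetConnected {N : Type*} [DecidableEq N] (r : N → N → Prop) (S : Finset N) : Prop :=
  S.Nonempty ∧ ∀ T ∈ S.powerset, T.Nonempty → T ≠ S → ∃ i ∈ T, ∃ j ∈ S \ T, r i j

instance {N : Type*} [DecidableEq N] (r : N → N → Prop) [DecidableRel r] (S : Finset N) :
    Decidable (SetConnected r S) := by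
  unfold SetConnected; infer_instance

/-- The cut formulation is decidable on small vertex types and needs no walks, which is why it
replaces `SimpleGraph.Connected` below. -/
theorem setConnected_adj_iff {N : Type*} [DecidableEq N] (G : SimpleGraph N) (S : Finset N) :
    SetConnected G.Adj S ↔ S.Nonempty ∧ (G.induce (S : Set N)).Connected := by
  classical
  refine and_congr_right fun hS => ⟨fun h => ?_, fun h T hT hne hTS => ?_⟩
  · have : Nonempty (S : Set N) := ⟨⟨hS.choose, hS.choose_spec⟩⟩
    refine ⟨fun a b => ?_⟩
    by_contra hab
    -- The cut condition is applied to the set of vertices reachable from `a`; an edge leaving it is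
    -- absurd.
    obtain ⟨i, hi, j, hj, hij⟩ := h
      (S.filter fun x => ∃ hx : x ∈ S, (G.induce (S : Set N)).Reachable a ⟨x, hx⟩)
      (by simp [filter_subset])
      ⟨a.1, by simp⟩
      (fun heq => hab (by
        have := (Finset.ext_iff.1 heq b.1).2 b.2
        simp only [mem_filter] at this
        exact this.2.2))
    simp only [mem_filter, mem_sdiff, not_and, not_exists] at hi hj
    obtain ⟨hiS, _, hr⟩ := hi
    refine hj.2 hj.1 hj.1 (hr.trans ?_)
    exact SimpleGraph.Adj.reachable (by simpa using hij)
  · rw [mem_powerset] at hT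
    obtain ⟨a, ha⟩ := hne
    obtain ⟨b, hbS, hbT⟩ := exists_of_ssubset (hT.ssubset_of_ne hTS)
    obtain ⟨w⟩ := h.preconnected ⟨a, hT ha⟩ ⟨b, hbS⟩
    obtain ⟨d, _, hd1, hd2⟩ := w.exists_boundary_dart {x | x.1 ∈ T} ha hbT
    exact ⟨d.fst, hd1, d.snd, mem_sdiff.2 ⟨d.snd.2, hd2⟩, by simpa using d.adj⟩

/-! ### Hyperplanes `H_I` and flats of rank two -/

section Hyperplanes

variable {F : Type*} [Field F] {N : Type*}

theorem mem_hyperplane {I : Finset N} {x : N → F} :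
    x ∈ hyperplane F I ↔ ∑ i ∈ I, x i = 0 := by
  simp [hyperplane, LinearMap.sum_apply]

variable [DecidableEq N]

theorem hyperplane_ne_top {I : Finset N} (hI : I.Nonempty) : hyperplane F I ≠ ⊤ := by
  intro h
  obtain ⟨i, hi⟩ := hI
  have : (Pi.single i 1 : N → F) ∈ hyperplane F I := h ▸ Submodule.mem_top
  simp [mem_hyperplane, hi] at this

theorem hyperplane_injective : Function.Injective (hyperplane F : Finset N → _) := by
  intro I J h
  ext i
  have := congrArg (fun H => (Pi.single i 1 : N → F) ∈ H) h
  simpa [mem_hyperplane, not_iff_not] using this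

omit [DecidableEq N] in
/-- A point of `H_P ∩ H_Q` lies in every hyperplane containing this intersection. -/
theorem sum_eq_zero_of_inf_le {P Q I : Finset N}
    (h : hyperplane F P ⊓ hyperplane F Q ≤ hyperplane F I) {x : N → F}
    (hP : ∑ i ∈ P, x i = 0) (hQ : ∑ i ∈ Q, x i = 0) : ∑ i ∈ I, x i = 0 :=
  mem_hyperplane.1 (h ⟨mem_hyperplane.2 hP, mem_hyperplane.2 hQ⟩)

theorem notMem_of_inf_le {P Q I : Finset N}
    (h : hyperplane F P ⊓ hyperplane F Q ≤ hyperplane F I) {i : N} (hP : i ∉ P) (hQ : i ∉ Q) :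
    i ∉ I := by
  intro hi
  have := sum_eq_zero_of_inf_le h (x := Pi.single i 1) (by simp [hP]) (by simp [hQ])
  simp [hi] at this

/-- The vector `e_i - e_j` lies in both hyperplanes, so `I` cannot separate `i` from `j`. Thus `I`
is a union of cells of the Venn diagram of `P` and `Q`. -/
theorem mem_iff_of_inf_le {P Q I : Finset N}
    (h : hyperplane F P ⊓ hyperplane F Q ≤ hyperplane F I) {i j : N} (hP : i ∈ P ↔ j ∈ P)
    (hQ : i ∈ Q ↔ j ∈ Q) : i ∈ I ↔ j ∈ I := by
  have := sum_eq_zero_of_inf_le h (x := Pi.single i 1 - Pi.single j 1)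
    (by simp [sum_sub_distrib, hP]) (by simp [sum_sub_distrib, hQ])
  by_cases hi : i ∈ I <;> by_cases hj : j ∈ I <;> simp_all [sum_sub_distrib]

/-- The only cells available to `I` are `P` and `Q \ P`. -/
theorem eq_of_inf_le_of_subset {P Q I : Finset N} (hPQ : P ⊆ Q) (hI : I.Nonempty)
    (h : hyperplane F P ⊓ hyperplane F Q ≤ hyperplane F I) : I = P ∨ I = Q ∨ I = Q \ P := by
  have h0 : I ⊆ Q := fun i hi => by
    by_contra hQ
    exact notMem_of_inf_le h (fun hP => hQ (hPQ hP)) hQ hi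
  have h1 : ∀ i ∈ P, ∀ j ∈ P, (i ∈ I → j ∈ I) := fun i hi j hj =>
    (mem_iff_of_inf_le h (by simp [hi, hj]) (by simp [hPQ hi, hPQ hj])).1
  have h2 : ∀ i ∈ Q, ∀ j ∈ Q, i ∉ P → j ∉ P → (i ∈ I → j ∈ I) := fun i hi j hj hi' hj' =>
    (mem_iff_of_inf_le h (by simp [hi', hj']) (by simp [hi, hj])).1
  by_cases c1 : ∃ i ∈ P, i ∈ I <;> by_cases c2 : ∃ i ∈ Q \ P, i ∈ I
  · refine .inr (.inl ?_); grind
  · refine .inl ?_; grind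
  · refine .inr (.inr ?_); grind
  · obtain ⟨i, hi⟩ := hI; grind

/-- Among unions of the three cells, the test vector `e_p + e_q - e_a` leaves only `P`, `Q` and the
empty set. Characteristic zero is what excludes the symmetric difference, on which it sums to `2`.
-/
theorem eq_of_inf_le_of_overlap [CharZero F] {P Q I : Finset N} (h1 : (P ∩ Q).Nonempty)
    (h2 : (P \ Q).Nonempty) (h3 : (Q \ P).Nonempty) (hI : I.Nonempty)
    (h : hyperplane F P ⊓ hyperplane F Q ≤ hyperplane F I) : I = P ∨ I = Q := by
  obtain ⟨a, ha⟩ := h1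
  obtain ⟨p, hp⟩ := h2
  obtain ⟨q, hq⟩ := h3
  simp only [mem_inter, mem_sdiff] at ha hp hq
  have key := sum_eq_zero_of_inf_le h
    (x := Pi.single p 1 + Pi.single q 1 - Pi.single a 1)
    (by simp [sum_sub_distrib, sum_add_distrib, ha, hp, hq])
    (by simp [sum_sub_distrib, sum_add_distrib, ha, hp, hq])
  have hI' : ∀ i, i ∈ I ↔
      i ∈ P ∧ i ∈ Q ∧ a ∈ I ∨ i ∈ P ∧ i ∉ Q ∧ p ∈ I ∨ i ∉ P ∧ i ∈ Q ∧ q ∈ I := by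
    intro i
    by_cases c1 : i ∈ P <;> by_cases c2 : i ∈ Q
    · simpa [c1, c2] using mem_iff_of_inf_le h (by simp [c1, ha]) (by simp [c2, ha])
    · simpa [c1, c2] using mem_iff_of_inf_le h (by simp [c1, hp]) (by simp [c2, hp])
    · simpa [c1, c2] using mem_iff_of_inf_le h (by simp [c1, hq]) (by simp [c2, hq])
    · simpa [c1, c2] using notMem_of_inf_le h c1 c2
  by_cases hpI : p ∈ I <;> by_cases hqI : q ∈ I <;> by_cases haI : a ∈ I <;>
    simp only [hpI, hqI, haI] at hI' <;>
    simp [sum_sub_distrib, sum_add_distrib, hpI, hqI, haI] at key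
  · exact .inl (Finset.ext fun i => by have := hI' i; tauto)
  · exact .inr (Finset.ext fun i => by have := hI' i; tauto)
  · obtain ⟨i, hi⟩ := hI
    have := hI' i; tauto

end Hyperplanes

/-! ### Constraints from flats of rank two -/

/-- The constraints which flats of rank two impose on the blocks of a nice partition: `c` assigns
a block to every connected subset of `U`. -/
structure RankTwoColoring {N α : Type*} [DecidableEq N] (r : N → N → Prop) (U : Finset N)
    (c : Finset N → α) : Prop where
  triple : ∀ P Q, P ⊆ U → Q ⊆ U → SetConnected r P → SetConnected r Q → Disjoint P Q →
    SetConnected r (P ∪ Q) → c P = c Q ∨ c P = c (P ∪ Q) ∨ c Q = c (P ∪ Q)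
  nested : ∀ P Q, P ⊂ Q → Q ⊆ U → SetConnected r P → SetConnected r Q →
    ¬ SetConnected r (Q \ P) → c P ≠ c Q
  overlap : ∀ P Q, P ⊆ U → Q ⊆ U → SetConnected r P → SetConnected r Q →
    (P ∩ Q).Nonempty → (P \ Q).Nonempty → (Q \ P).Nonempty → c P ≠ c Q

theorem mem_arrangement_iff {F : Type*} [Field F] {N : Type*} [DecidableEq N]
    {G : SimpleGraph N} {H : Submodule F (N → F)} :
    H ∈ arrangement F G ↔ ∃ I, SetConnected G.Adj I ∧ H = hyperplane F I := by
  simp only [arrangement, setConnected_adj_iff, Set.mem_ofPred_eq, and_assoc]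

/-- The colour of `I` is the set of indices of blocks containing `H_I`, a singleton when `I` is
connected. Independence gives `triple`; the singleton condition gives `nested` and `overlap`. -/
theorem rankTwoColoring_of_isNicePartition {F : Type*} [Field F] [CharZero F] {N : Type*}
    [Fintype N] [DecidableEq N] {G : SimpleGraph N} {ι : Type*}
    {π : ι → Set (Submodule F (N → F))} (hπ : IsNicePartition (arrangement F G) π) :
    RankTwoColoring G.Adj univ fun I => {i | hyperplane F I ∈ π i} := by
  classical
  have hmem : ∀ {I}, SetConnected G.Adj I → ∃ i, hyperplane F I ∈ π i := fun {I} hI => by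
    have : hyperplane F I ∈ ⋃ i, π i := by
      rw [hπ.partition.union]; exact mem_arrangement_iff.2 ⟨I, hI, rfl⟩
    simpa using this
  have huniq : ∀ {H i j}, H ∈ π i → H ∈ π j → i = j := fun {H i j} hi hj => by
    by_contra hij
    exact Set.disjoint_left.1 (hπ.partition.disjoint hij) hi hj
  have hcol : ∀ {I i}, hyperplane F I ∈ π i → {i | hyperplane F I ∈ π i} = {i} := fun hi =>
    Set.ext fun j => ⟨fun hj => huniq hj hi, fun hj => by
      rw [Set.mem_singleton_iff.1 hj]; exact hi⟩
  have hne : ∀ P Q, SetConnected G.Adj P → SetConnected G.Adj Q → P ≠ Q →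
      (∀ I, SetConnected G.Adj I → hyperplane F P ⊓ hyperplane F Q ≤ hyperplane F I →
        I = P ∨ I = Q) → {i | hyperplane F P ∈ π i} ≠ {i | hyperplane F Q ∈ π i} := by
    intro P Q hP hQ hPQ hI heq
    -- Some block has a single member above the flat `H_P ∩ H_Q`. That member is `H_P` or `H_Q`, so
    -- with equal colours the block contains both.
    obtain ⟨B, ⟨-, i, rfl⟩, H, hH⟩ := hπ.singleton (sInf {hyperplane F P, hyperplane F Q})
      ⟨_, by
        rintro _ (rfl | rfl)
        exacts [mem_arrangement_iff.2 ⟨P, hP, rfl⟩, mem_arrangement_iff.2 ⟨Q, hQ, rfl⟩], rfl⟩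
      (fun h => hyperplane_ne_top (F := F) hP.1 (top_le_iff.1 (h ▸ sInf_le (by simp))))
    rw [sInf_pair] at hH
    have hHm : H ∈ π i ∩ localization (arrangement F G) (hyperplane F P ⊓ hyperplane F Q) := by
      rw [hH]; rfl
    obtain ⟨I, hIc, rfl⟩ := mem_arrangement_iff.1 hHm.2.1
    have hi : hyperplane F P ∈ π i ∧ hyperplane F Q ∈ π i := by
      rcases hI I hIc hHm.2.2 with rfl | rfl
      · exact ⟨hHm.1, (Set.ext_iff.1 heq i).1 hHm.1⟩
      · exact ⟨(Set.ext_iff.1 heq i).2 hHm.1, hHm.1⟩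
    have hP' : hyperplane F P = hyperplane F I := by
      rw [← Set.mem_singleton_iff, ← hH]
      exact ⟨hi.1, mem_arrangement_iff.2 ⟨P, hP, rfl⟩, inf_le_left⟩
    have hQ' : hyperplane F Q = hyperplane F I := by
      rw [← Set.mem_singleton_iff, ← hH]
      exact ⟨hi.2, mem_arrangement_iff.2 ⟨Q, hQ, rfl⟩, inf_le_right⟩
    exact hPQ (hyperplane_injective (hP'.trans hQ'.symm))
  constructor
  · intro P Q _ _ hP hQ hd hPQ
    obtain ⟨i, hi⟩ := hmem hP
    obtain ⟨j, hj⟩ := hmem hQ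
    obtain ⟨k, hk⟩ := hmem hPQ
    simp only [hcol hi, hcol hj, hcol hk, Set.singleton_eq_singleton_iff]
    by_contra! hijk
    obtain ⟨hij, hik, hjk⟩ := hijk
    have hex : ∀ l, ∃ I : Finset N, hyperplane F I ∈ π l := fun l => by
      obtain ⟨H, hH⟩ := hπ.partition.nonempty l
      have : H ∈ arrangement F G := by
        rw [← hπ.partition.union]; exact Set.mem_iUnion.2 ⟨l, hH⟩
      obtain ⟨I, -, rfl⟩ := mem_arrangement_iff.1 this
      exact ⟨I, hH⟩
    choose J hJ using hex
    -- Independence speaks of full choices, so `P`, `Q`, `P ∪ Q` are completed by arbitrary members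
    -- of the remaining blocks.
    let K : ι → Finset N := fun l => if l = i then P else if l = j then Q else
      if l = k then P ∪ Q else J l
    have hKi : K i = P := by simp [K]
    have hKj : K j = Q := by simp [K, hij.symm]
    have hKk : K k = P ∪ Q := by simp [K, hik.symm, hjk.symm]
    have hind := hπ.independent (fun l => ∑ x ∈ K l, (LinearMap.proj x : (N → F) →ₗ[F] F))
      (fun l => by
        change hyperplane F (K l) ∈ π l
        by_cases h1 : l = i
        · subst h1; rwa [hKi]
        by_cases h2 : l = j
        · subst h2; rwa [hKj]
        by_cases h3 : l = k
        · subst h3; rwa [hKk]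
        simpa [K, h1, h2, h3] using hJ l)
    -- The coefficients come from `x_P + x_Q - x_{P ∪ Q} = 0`.
    have := linearIndependent_iff'.1 hind {i, j, k}
      (fun l => if l = k then -1 else 1) (by
        rw [sum_insert (by simp [hij, hik]), sum_insert (by simp [hjk]), sum_singleton]
        simp [hKi, hKj, hKk, hik, hjk, sum_union hd, ← add_assoc]) i (by simp)
    simp [hik] at this
  · intro P Q hPQ _ hP hQ hn
    refine hne P Q hP hQ hPQ.ne fun I hI h => ?_
    rcases eq_of_inf_le_of_subset hPQ.1 hI.1 h with h | h | h
    exacts [.inl h, .inr h, absurd (h ▸ hI) hn]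
  · intro P Q _ _ hP hQ h1 h2 h3
    refine hne P Q hP hQ (fun h => by simp [h] at h2) fun I hI h =>
      eq_of_inf_le_of_overlap h1 h2 h3 hI.1 h

/-! ### Induced minors -/

section Minors

variable {M N : Type*} [DecidableEq M] [DecidableEq N] {r : N → N → Prop} {s : M → M → Prop}

/-- Cuts of `S` lift to cuts of the union of pieces. Conversely, a cut of the union either splits a
piece, and connectedness of that piece supplies the pair, or is a union of pieces and comes from a
cut of `S`. -/
theorem setConnected_biUnion_iff {f : M → Finset N} {U : Finset M}
    (hconn : ∀ i ∈ U, SetConnected r (f i))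
    (hdisj : ∀ i ∈ U, ∀ j ∈ U, ∀ u ∈ f i, u ∈ f j → i = j)
    (hadj : ∀ i ∈ U, ∀ j ∈ U, i ≠ j → (s i j ↔ ∃ u ∈ f i, ∃ v ∈ f j, r u v))
    {S : Finset M} (hS : S ⊆ U) : SetConnected r (S.biUnion f) ↔ SetConnected s S := by
  constructor
  · refine fun ⟨hne, h⟩ => ⟨by
      obtain ⟨x, hx⟩ := hne
      obtain ⟨i, hi, -⟩ := mem_biUnion.1 hx
      exact ⟨i, hi⟩, fun T hT hTne hTS => ?_⟩
    rw [mem_powerset] at hT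
    obtain ⟨k, hk⟩ := hTne
    obtain ⟨l, hlS, hlT⟩ := exists_of_ssubset (hT.ssubset_of_ne hTS)
    obtain ⟨x, hx⟩ := (hconn k (hS (hT hk))).1
    obtain ⟨y, hy⟩ := (hconn l (hS hlS)).1
    obtain ⟨u, hu, v, hv, huv⟩ := h (T.biUnion f)
      (mem_powerset.2 (biUnion_subset_biUnion_of_subset_left f hT))
      ⟨x, mem_biUnion.2 ⟨k, hk, hx⟩⟩ (fun heq => by
        obtain ⟨m, hm, hym⟩ := mem_biUnion.1 (heq ▸ mem_biUnion.2 ⟨l, hlS, hy⟩ : y ∈ T.biUnion f)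
        exact hlT (hdisj m (hS (hT hm)) l (hS hlS) y hym hy ▸ hm))
    obtain ⟨i, hi, hui⟩ := mem_biUnion.1 hu
    obtain ⟨hvS, hvT⟩ := mem_sdiff.1 hv
    obtain ⟨j, hj, hvj⟩ := mem_biUnion.1 hvS
    have hjT : j ∉ T := fun hjT => hvT (mem_biUnion.2 ⟨j, hjT, hvj⟩)
    exact ⟨i, hi, j, mem_sdiff.2 ⟨hj, hjT⟩,
      (hadj i (hS (hT hi)) j (hS hj) (fun e => hjT (e ▸ hi))).2 ⟨u, hui, v, hvj, huv⟩⟩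
  · refine fun ⟨hne, h⟩ => ⟨by
      obtain ⟨i, hi⟩ := hne
      obtain ⟨x, hx⟩ := (hconn i (hS hi)).1
      exact ⟨x, mem_biUnion.2 ⟨i, hi, hx⟩⟩, fun T hT hTne hTS => ?_⟩
    rw [mem_powerset] at hT
    by_cases hsplit : ∃ i ∈ S, (T ∩ f i).Nonempty ∧ T ∩ f i ≠ f i
    · obtain ⟨i, hi, hne, hni⟩ := hsplit
      obtain ⟨u, hu, v, hv, huv⟩ :=
        (hconn i (hS hi)).2 _ (mem_powerset.2 inter_subset_right) hne hni
      rw [mem_inter] at hu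
      rw [mem_sdiff, mem_inter] at hv
      exact ⟨u, hu.1, v, mem_sdiff.2 ⟨mem_biUnion.2 ⟨i, hi, hv.1⟩, fun hvT => hv.2 ⟨hvT, hv.1⟩⟩,
        huv⟩
    · push Not at hsplit
      have hsub : ∀ i ∈ S, ∀ x ∈ f i, x ∈ T → f i ⊆ T := fun i hi x hx hxT =>
        inter_eq_right.1 (hsplit i hi ⟨x, mem_inter.2 ⟨hxT, hx⟩⟩)
      obtain ⟨x, hx⟩ := hTne
      obtain ⟨k, hk, hxk⟩ := mem_biUnion.1 (hT hx)
      obtain ⟨y, hyS, hyT⟩ := exists_of_ssubset (hT.ssubset_of_ne hTS)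
      obtain ⟨l, hl, hyl⟩ := mem_biUnion.1 hyS
      obtain ⟨i, hi, j, hj, hij⟩ := h (S.filter fun i => f i ⊆ T)
        (mem_powerset.2 (filter_subset _ _))
        ⟨k, mem_filter.2 ⟨hk, hsub k hk x hxk hx⟩⟩
        (fun heq => hyT ((mem_filter.1 ((Finset.ext_iff.1 heq l).2 hl)).2 hyl))
      simp only [mem_sdiff, mem_filter, not_and] at hi hj
      obtain ⟨u, hu, v, hv, huv⟩ := (hadj i (hS hi.1) j (hS hj.1) (fun e => hj.2 hj.1
        (e ▸ hi.2))).1 hij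
      exact ⟨u, hi.2 hu, v, mem_sdiff.2 ⟨mem_biUnion.2 ⟨j, hj.1, hv⟩, fun hvT =>
        hj.2 hj.1 (hsub j hj.1 v hv hvT)⟩, huv⟩

/-- Contracting disjoint connected sets `f i` preserves the constraints on the blocks. -/
theorem RankTwoColoring.contract {α : Type*} {c : Finset N → α} {W : Finset N}
    (h : RankTwoColoring r W c) {f : M → Finset N} {U : Finset M}
    (hsub : ∀ i ∈ U, f i ⊆ W)
    (hconn : ∀ i ∈ U, SetConnected r (f i))
    (hdisj : ∀ i ∈ U, ∀ j ∈ U, ∀ u ∈ f i, u ∈ f j → i = j)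
    (hadj : ∀ i ∈ U, ∀ j ∈ U, i ≠ j → (s i j ↔ ∃ u ∈ f i, ∃ v ∈ f j, r u v)) :
    RankTwoColoring s U fun S => c (S.biUnion f) := by
  have hW : ∀ P, P ⊆ U → P.biUnion f ⊆ W := fun P hP =>
    biUnion_subset.2 fun i hi => hsub i (hP hi)
  have hc : ∀ P, P ⊆ U → (SetConnected r (P.biUnion f) ↔ SetConnected s P) := fun P hP =>
    setConnected_biUnion_iff hconn hdisj hadj hP
  have hmem : ∀ P i x, P ⊆ U → i ∈ U → x ∈ f i → (x ∈ P.biUnion f ↔ i ∈ P) := by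
    refine fun P i x hP hi hx => ⟨fun hxP => ?_, fun hiP => mem_biUnion.2 ⟨i, hiP, hx⟩⟩
    obtain ⟨j, hj, hxj⟩ := mem_biUnion.1 hxP
    exact hdisj j (hP hj) i hi x hxj hx ▸ hj
  have hsd : ∀ P Q, P ⊆ U → Q ⊆ U → P.biUnion f \ Q.biUnion f = (P \ Q).biUnion f := by
    intro P Q hP hQ
    ext x
    simp only [mem_sdiff, mem_biUnion]
    constructor
    · rintro ⟨⟨i, hi, hx⟩, hn⟩
      exact ⟨i, ⟨hi, fun hiQ => hn ⟨i, hiQ, hx⟩⟩, hx⟩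
    · rintro ⟨i, ⟨hi, hn⟩, hx⟩
      exact ⟨⟨i, hi, hx⟩, fun hxQ => hn ((hmem Q i x hQ (hP hi) hx).1 (mem_biUnion.2 hxQ))⟩
  have hneb : ∀ P, P ⊆ U → P.Nonempty → (P.biUnion f).Nonempty := by
    rintro P hP ⟨i, hi⟩
    obtain ⟨x, hx⟩ := (hconn i (hP hi)).1
    exact ⟨x, mem_biUnion.2 ⟨i, hi, hx⟩⟩
  have hsdn : ∀ P Q, P ⊆ U → Q ⊆ U → (P \ Q).Nonempty → (P.biUnion f \ Q.biUnion f).Nonempty :=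
    fun P Q hP hQ hne => hsd P Q hP hQ ▸ hneb _ (sdiff_subset.trans hP) hne
  constructor
  · intro P Q hP hQ hPc hQc hd hPQ
    have hu : (P ∪ Q).biUnion f = P.biUnion f ∪ Q.biUnion f := union_biUnion ..
    have := h.triple (P.biUnion f) (Q.biUnion f) (hW P hP) (hW Q hQ) ((hc P hP).2 hPc)
      ((hc Q hQ).2 hQc) (disjoint_left.2 fun x hx hxQ => by
        obtain ⟨i, hi, hxi⟩ := mem_biUnion.1 hx
        exact disjoint_left.1 hd hi ((hmem Q i x hQ (hP hi) hxi).1 hxQ))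
      (hu ▸ (hc _ (union_subset hP hQ)).2 hPQ)
    rwa [← hu] at this
  · intro P Q hPQ hQ hPc hQc hn
    have hP := hPQ.1.trans hQ
    obtain ⟨x, hx⟩ := hsdn Q P hQ hP (sdiff_nonempty.2 hPQ.2)
    refine h.nested _ _ ⟨biUnion_subset_biUnion_of_subset_left f hPQ.1, fun hle => ?_⟩ (hW Q hQ)
      ((hc P hP).2 hPc) ((hc Q hQ).2 hQc) ?_
    · exact (mem_sdiff.1 hx).2 (hle (mem_sdiff.1 hx).1)
    · rwa [hsd Q P hQ hP, hc _ (sdiff_subset.trans hQ)]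
  · intro P Q hP hQ hPc hQc h1 h2 h3
    refine h.overlap _ _ (hW P hP) (hW Q hQ) ((hc P hP).2 hPc) ((hc Q hQ).2 hQc) ?_
      (hsdn P Q hP hQ h2) (hsdn Q P hQ hP h3)
    obtain ⟨x, hx⟩ := hneb _ (inter_subset_left.trans hP) h1
    obtain ⟨i, hi, hxi⟩ := mem_biUnion.1 hx
    rw [mem_inter] at hi
    exact ⟨x, mem_inter.2 ⟨mem_biUnion.2 ⟨i, hi.1, hxi⟩, mem_biUnion.2 ⟨i, hi.2, hxi⟩⟩⟩

end Minors

/-! ### Five graphs without a colouring -/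

section SmallGraphs

variable {N α : Type*} [Fintype N] [DecidableEq N] {r : N → N → Prop} {c : Finset N → α}

theorem RankTwoColoring.triple_of (h : RankTwoColoring r univ c) (P Q R : Finset N)
    (hPQR : SetConnected r P ∧ SetConnected r Q ∧ SetConnected r R ∧ Disjoint P Q ∧ P ∪ Q = R) :
    c P = c Q ∨ c P = c R ∨ c Q = c R := by
  obtain ⟨hP, hQ, hR, hd, rfl⟩ := hPQR
  exact h.triple P Q (subset_univ _) (subset_univ _) hP hQ hd hR

/-- Both kinds of inequality are merged, with all side conditions in one decidable proposition so
that `decide` can settle them. -/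
theorem RankTwoColoring.ne_of (h : RankTwoColoring r univ c) (P Q : Finset N)
    (hPQ : SetConnected r P ∧ SetConnected r Q ∧ (P \ Q = ∅ → ¬ SetConnected r (Q \ P)) ∧
      (P ∩ Q).Nonempty ∧ (Q \ P).Nonempty) : c P ≠ c Q := by
  obtain ⟨hP, hQ, h1, h2, h3⟩ := hPQ
  by_cases h4 : (P \ Q).Nonempty
  · exact h.overlap P Q (subset_univ _) (subset_univ _) hP hQ h2 h4 h3
  · have := not_nonempty_iff_eq_empty.1 h4
    exact h.nested P Q ⟨sdiff_eq_empty_iff_subset.1 this, sdiff_nonempty.1 h3⟩ (subset_univ _) hP hQ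
      (h1 this)

/-- The claw, with centre `0`. -/
abbrev claw (i j : Fin 4) : Prop := i ≠ j ∧ (i = 0 ∨ j = 0)

/-- The listed equality alternatives and inequalities have no solution with any number of colours.
The same holds for the instances chosen for the other four graphs. -/
theorem not_rankTwoColoring_claw {α : Type*} {c : Finset (Fin 4) → α} :
    ¬ RankTwoColoring claw univ c := by
  intro h
  have := h.triple_of {0} {1} {0, 1} (by decide)
  have := h.triple_of {1} {0, 2, 3} {0, 1, 2, 3} (by decide)
  have := h.triple_of {0, 1} {2} {0, 1, 2} (by decide)
  have := h.triple_of {0, 1} {3} {0, 1, 3} (by decide)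
  have := h.triple_of {2} {0, 3} {0, 2, 3} (by decide)
  have := h.triple_of {0, 2} {3} {0, 2, 3} (by decide)
  have := h.ne_of {0} {0, 1, 2} (by decide)
  have := h.ne_of {0} {0, 1, 3} (by decide)
  have := h.ne_of {0} {0, 2, 3} (by decide)
  have := h.ne_of {0} {0, 1, 2, 3} (by decide)
  have := h.ne_of {0, 1} {0, 1, 2, 3} (by decide)
  have := h.ne_of {0, 2} {0, 1, 2, 3} (by decide)
  have := h.ne_of {0, 3} {0, 1, 2, 3} (by decide)
  have := h.ne_of {0, 1} {0, 2} (by decide)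
  have := h.ne_of {0, 1} {0, 3} (by decide)
  have := h.ne_of {0, 1} {0, 2, 3} (by decide)
  have := h.ne_of {0, 2} {0, 3} (by decide)
  have := h.ne_of {0, 2} {0, 1, 3} (by decide)
  have := h.ne_of {0, 1, 2} {0, 3} (by decide)
  have := h.ne_of {0, 1, 2} {0, 1, 3} (by decide)
  have := h.ne_of {0, 1, 2} {0, 2, 3} (by decide)
  have := h.ne_of {0, 1, 3} {0, 2, 3} (by decide)
  clear h
  grind

/-- The cycle on four vertices. -/
abbrev cycleFour (i j : Fin 4) : Prop := i + 1 = j ∨ j + 1 = i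

theorem not_rankTwoColoring_cycleFour {α : Type*} {c : Finset (Fin 4) → α} :
    ¬ RankTwoColoring cycleFour univ c := by
  intro h
  have := h.triple_of {1} {0, 3} {0, 1, 3} (by decide)
  have := h.triple_of {1} {2, 3} {1, 2, 3} (by decide)
  have := h.triple_of {1} {0, 2, 3} {0, 1, 2, 3} (by decide)
  have := h.triple_of {0, 1} {2} {0, 1, 2} (by decide)
  have := h.triple_of {0, 1} {2, 3} {0, 1, 2, 3} (by decide)
  have := h.triple_of {2} {0, 3} {0, 2, 3} (by decide)
  have := h.triple_of {1, 2} {0, 3} {0, 1, 2, 3} (by decide)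
  have := h.ne_of {1} {0, 1, 2} (by decide)
  have := h.ne_of {0, 1} {1, 2} (by decide)
  have := h.ne_of {0, 1} {0, 3} (by decide)
  have := h.ne_of {0, 1} {0, 2, 3} (by decide)
  have := h.ne_of {0, 1} {1, 2, 3} (by decide)
  have := h.ne_of {1, 2} {0, 1, 3} (by decide)
  have := h.ne_of {1, 2} {2, 3} (by decide)
  have := h.ne_of {1, 2} {0, 2, 3} (by decide)
  have := h.ne_of {0, 1, 2} {0, 3} (by decide)
  have := h.ne_of {0, 1, 2} {2, 3} (by decide)
  have := h.ne_of {0, 1, 2} {0, 2, 3} (by decide)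
  have := h.ne_of {0, 3} {2, 3} (by decide)
  have := h.ne_of {0, 3} {1, 2, 3} (by decide)
  have := h.ne_of {0, 1, 3} {2, 3} (by decide)
  have := h.ne_of {0, 1, 3} {0, 2, 3} (by decide)
  have := h.ne_of {0, 1, 3} {1, 2, 3} (by decide)
  have := h.ne_of {0, 2, 3} {1, 2, 3} (by decide)
  clear h
  grind

/-- The complete graph on four vertices without the edge between `1` and `3`. -/
abbrev diamond (i j : Fin 4) : Prop := i ≠ j ∧ (i ∈ ({0, 2} : Finset _) ∨ j ∈ ({0, 2} : Finset _))

theorem not_rankTwoColoring_diamond {α : Type*} {c : Finset (Fin 4) → α} :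
    ¬ RankTwoColoring diamond univ c := by
  intro h
  have := h.triple_of {1} {2} {1, 2} (by decide)
  have := h.triple_of {1} {0, 2} {0, 1, 2} (by decide)
  have := h.triple_of {1} {0, 3} {0, 1, 3} (by decide)
  have := h.triple_of {0, 1} {2} {0, 1, 2} (by decide)
  have := h.triple_of {0, 1} {2, 3} {0, 1, 2, 3} (by decide)
  have := h.triple_of {2} {0, 3} {0, 2, 3} (by decide)
  have := h.triple_of {1, 2} {0, 3} {0, 1, 2, 3} (by decide)
  have := h.ne_of {0, 1} {0, 2} (by decide)
  have := h.ne_of {0, 1} {1, 2} (by decide)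
  have := h.ne_of {0, 1} {0, 3} (by decide)
  have := h.ne_of {0, 1} {0, 2, 3} (by decide)
  have := h.ne_of {0, 2} {1, 2} (by decide)
  have := h.ne_of {0, 2} {0, 3} (by decide)
  have := h.ne_of {0, 2} {0, 1, 3} (by decide)
  have := h.ne_of {1, 2} {0, 1, 3} (by decide)
  have := h.ne_of {1, 2} {2, 3} (by decide)
  have := h.ne_of {1, 2} {0, 2, 3} (by decide)
  have := h.ne_of {0, 1, 2} {0, 3} (by decide)
  have := h.ne_of {0, 1, 2} {0, 1, 3} (by decide)
  have := h.ne_of {0, 1, 2} {2, 3} (by decide)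
  have := h.ne_of {0, 1, 2} {0, 2, 3} (by decide)
  have := h.ne_of {0, 3} {2, 3} (by decide)
  have := h.ne_of {0, 1, 3} {2, 3} (by decide)
  have := h.ne_of {0, 1, 3} {0, 2, 3} (by decide)
  clear h
  grind

/-- The complete graph on four vertices. -/
abbrev completeFour (i j : Fin 4) : Prop := i ≠ j

theorem not_rankTwoColoring_completeFour {α : Type*} {c : Finset (Fin 4) → α} :
    ¬ RankTwoColoring completeFour univ c := by
  intro h
  have := h.triple_of {1} {2} {1, 2} (by decide)
  have := h.triple_of {1} {0, 2} {0, 1, 2} (by decide)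
  have := h.triple_of {1} {2, 3} {1, 2, 3} (by decide)
  have := h.triple_of {0, 1} {2} {0, 1, 2} (by decide)
  have := h.triple_of {0, 1} {3} {0, 1, 3} (by decide)
  have := h.triple_of {2} {1, 3} {1, 2, 3} (by decide)
  have := h.triple_of {0, 2} {3} {0, 2, 3} (by decide)
  have := h.ne_of {0, 1} {0, 2} (by decide)
  have := h.ne_of {0, 1} {1, 2} (by decide)
  have := h.ne_of {0, 1} {1, 3} (by decide)
  have := h.ne_of {0, 1} {0, 2, 3} (by decide)
  have := h.ne_of {0, 1} {1, 2, 3} (by decide)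
  have := h.ne_of {0, 2} {1, 2} (by decide)
  have := h.ne_of {0, 2} {0, 1, 3} (by decide)
  have := h.ne_of {0, 2} {2, 3} (by decide)
  have := h.ne_of {0, 2} {1, 2, 3} (by decide)
  have := h.ne_of {1, 2} {1, 3} (by decide)
  have := h.ne_of {1, 2} {2, 3} (by decide)
  have := h.ne_of {0, 1, 2} {1, 3} (by decide)
  have := h.ne_of {0, 1, 2} {0, 1, 3} (by decide)
  have := h.ne_of {0, 1, 2} {2, 3} (by decide)
  have := h.ne_of {0, 1, 2} {0, 2, 3} (by decide)
  have := h.ne_of {0, 1, 2} {1, 2, 3} (by decide)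
  have := h.ne_of {1, 3} {2, 3} (by decide)
  have := h.ne_of {1, 3} {0, 2, 3} (by decide)
  have := h.ne_of {0, 1, 3} {2, 3} (by decide)
  have := h.ne_of {0, 1, 3} {0, 2, 3} (by decide)
  clear h
  grind

/-- Two triangles which share the vertex `0`. -/
abbrev bowtie (i j : Fin 5) : Prop := i ≠ j ∧ (i = 0 ∨ j = 0 ∨ (i ∈ ({1, 2} : Finset _) ↔ j ∈ ({1, 2} : Finset _)))

theorem not_rankTwoColoring_bowtie {α : Type*} {c : Finset (Fin 5) → α} :
    ¬ RankTwoColoring bowtie univ c := by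
  intro h
  have := h.triple_of {0} {3} {0, 3} (by decide)
  have := h.triple_of {0} {4} {0, 4} (by decide)
  have := h.triple_of {1} {0, 3} {0, 1, 3} (by decide)
  have := h.triple_of {1} {0, 4} {0, 1, 4} (by decide)
  have := h.triple_of {1} {0, 2, 4} {0, 1, 2, 4} (by decide)
  have := h.triple_of {0, 2} {4} {0, 2, 4} (by decide)
  have := h.triple_of {3} {0, 1, 2, 4} {0, 1, 2, 3, 4} (by decide)
  have := h.triple_of {0, 1, 2, 3} {4} {0, 1, 2, 3, 4} (by decide)
  have := h.ne_of {0} {0, 1, 3} (by decide)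
  have := h.ne_of {0} {0, 1, 2, 3} (by decide)
  have := h.ne_of {0} {0, 1, 4} (by decide)
  have := h.ne_of {0} {0, 2, 4} (by decide)
  have := h.ne_of {0} {0, 1, 2, 4} (by decide)
  have := h.ne_of {0} {0, 1, 2, 3, 4} (by decide)
  have := h.ne_of {0, 2} {0, 1, 2, 4} (by decide)
  have := h.ne_of {0, 3} {0, 1, 2, 3, 4} (by decide)
  have := h.ne_of {0, 4} {0, 1, 2, 3, 4} (by decide)
  have := h.ne_of {0, 1, 4} {0, 1, 2, 3, 4} (by decide)
  have := h.ne_of {0, 2, 4} {0, 1, 2, 3, 4} (by decide)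
  have := h.ne_of {0, 2} {0, 3} (by decide)
  have := h.ne_of {0, 2} {0, 1, 3} (by decide)
  have := h.ne_of {0, 2} {0, 1, 4} (by decide)
  have := h.ne_of {0, 3} {0, 4} (by decide)
  have := h.ne_of {0, 3} {0, 1, 2, 4} (by decide)
  have := h.ne_of {0, 1, 3} {0, 4} (by decide)
  have := h.ne_of {0, 1, 3} {0, 1, 4} (by decide)
  have := h.ne_of {0, 1, 3} {0, 1, 2, 4} (by decide)
  have := h.ne_of {0, 1, 2, 3} {0, 4} (by decide)
  have := h.ne_of {0, 1, 2, 3} {0, 1, 2, 4} (by decide)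
  have := h.ne_of {0, 1, 4} {0, 2, 4} (by decide)
  clear h
  grind

end SmallGraphs

/-! ### The five graphs as forbidden induced minors -/

section Obstructions

variable {N α : Type*} [DecidableEq N] {r : N → N → Prop} {W : Finset N} {c : Finset N → α}

/-- Some element of `A` is related to some element of `B`. -/
def Touches (r : N → N → Prop) (A B : Finset N) : Prop := ∃ u ∈ A, ∃ v ∈ B, r u v

omit [DecidableEq N] in
theorem Touches.symm (hr : ∀ i j, r i j → r j i) {A B : Finset N} (h : Touches r A B) : Touches r B A := by
  obtain ⟨u, hu, v, hv, huv⟩ := h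
  exact ⟨v, hv, u, hu, hr _ _ huv⟩

/-- Disjoint connected sets whose adjacencies form the graph `s` yield constraints for `s`. -/
theorem RankTwoColoring.of_blocks {k : ℕ} {s : Fin k → Fin k → Prop} (h : RankTwoColoring r W c)
    (hr : ∀ i j, r i j → r j i) (hs : ∀ i j, s i j → s j i) (f : Fin k → Finset N)
    (hf : ∀ i, f i ⊆ W ∧ SetConnected r (f i))
    (hadj : ∀ i j, i < j → Disjoint (f i) (f j) ∧ (s i j ↔ Touches r (f i) (f j))) :
    RankTwoColoring s univ fun S => c (S.biUnion f) := by
  refine h.contract (fun i _ => (hf i).1) (fun i _ => (hf i).2) (fun i _ j _ u hi hj => ?_)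
    fun i _ j _ hij => ?_
  · rcases lt_trichotomy i j with h | h | h
    · exact absurd hj (disjoint_left.1 (hadj i j h).1 hi)
    · exact h
    · exact absurd hi (disjoint_left.1 (hadj j i h).1 hj)
  · rcases lt_or_gt_of_ne hij with h | h
    · exact (hadj i j h).2
    · exact ⟨fun h' => ((hadj j i h).2.1 (hs _ _ h')).symm hr,
        fun h' => hs _ _ ((hadj j i h).2.2 (Touches.symm hr h'))⟩

theorem RankTwoColoring.not_claw (h : RankTwoColoring r W c) (hr : ∀ i j, r i j → r j i)
    {A B C D : Finset N} (hW : A ⊆ W ∧ B ⊆ W ∧ C ⊆ W ∧ D ⊆ W)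
    (hA : SetConnected r A) (hB : SetConnected r B) (hC : SetConnected r C)
    (hD : SetConnected r D)
    (hd : Disjoint A B ∧ Disjoint A C ∧ Disjoint A D ∧ Disjoint B C ∧ Disjoint B D ∧ Disjoint C D)
    (hAB : Touches r A B) (hAC : Touches r A C) (hAD : Touches r A D)
    (hn : ¬ Touches r B C ∧ ¬ Touches r B D ∧ ¬ Touches r C D) : False := by
  refine not_rankTwoColoring_claw (h.of_blocks (s := claw) hr (by decide) ![A, B, C, D] ?_ ?_)
  · simp [Fin.forall_fin_succ, *]
  · simp [Fin.forall_fin_succ, *]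
    decide

theorem RankTwoColoring.not_cycleFour (h : RankTwoColoring r W c) (hr : ∀ i j, r i j → r j i)
    {A B C D : Finset N} (hW : A ⊆ W ∧ B ⊆ W ∧ C ⊆ W ∧ D ⊆ W)
    (hA : SetConnected r A) (hB : SetConnected r B) (hC : SetConnected r C)
    (hD : SetConnected r D)
    (hd : Disjoint A B ∧ Disjoint A C ∧ Disjoint A D ∧ Disjoint B C ∧ Disjoint B D ∧ Disjoint C D)
    (hAB : Touches r A B) (hBC : Touches r B C) (hCD : Touches r C D) (hAD : Touches r A D)
    (hn : ¬ Touches r A C ∧ ¬ Touches r B D) : False := by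
  refine not_rankTwoColoring_cycleFour
    (h.of_blocks (s := cycleFour) hr (by decide) ![A, B, C, D] ?_ ?_)
  · simp [Fin.forall_fin_succ, *]
  · simp [Fin.forall_fin_succ, *]
    decide

theorem RankTwoColoring.not_diamond (h : RankTwoColoring r W c) (hr : ∀ i j, r i j → r j i)
    {A B C D : Finset N} (hW : A ⊆ W ∧ B ⊆ W ∧ C ⊆ W ∧ D ⊆ W)
    (hA : SetConnected r A) (hB : SetConnected r B) (hC : SetConnected r C)
    (hD : SetConnected r D)
    (hd : Disjoint A B ∧ Disjoint A C ∧ Disjoint A D ∧ Disjoint B C ∧ Disjoint B D ∧ Disjoint C D)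
    (hAB : Touches r A B) (hAC : Touches r A C) (hAD : Touches r A D) (hBC : Touches r B C)
    (hCD : Touches r C D) (hn : ¬ Touches r B D) : False := by
  refine not_rankTwoColoring_diamond
    (h.of_blocks (s := diamond) hr (by decide) ![A, B, C, D] ?_ ?_)
  · simp [Fin.forall_fin_succ, *]
  · simp [Fin.forall_fin_succ, *]
    decide

theorem RankTwoColoring.not_completeFour (h : RankTwoColoring r W c) (hr : ∀ i j, r i j → r j i)
    {A B C D : Finset N} (hW : A ⊆ W ∧ B ⊆ W ∧ C ⊆ W ∧ D ⊆ W)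
    (hA : SetConnected r A) (hB : SetConnected r B) (hC : SetConnected r C)
    (hD : SetConnected r D)
    (hd : Disjoint A B ∧ Disjoint A C ∧ Disjoint A D ∧ Disjoint B C ∧ Disjoint B D ∧ Disjoint C D)
    (hAB : Touches r A B) (hAC : Touches r A C) (hAD : Touches r A D) (hBC : Touches r B C)
    (hBD : Touches r B D) (hCD : Touches r C D) : False := by
  refine not_rankTwoColoring_completeFour
    (h.of_blocks (s := completeFour) hr (by decide) ![A, B, C, D] ?_ ?_)
  · simp [Fin.forall_fin_succ, *]
  · simp [Fin.forall_fin_succ, *]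

theorem RankTwoColoring.not_bowtie (h : RankTwoColoring r W c) (hr : ∀ i j, r i j → r j i)
    {A B C D E : Finset N} (hW : A ⊆ W ∧ B ⊆ W ∧ C ⊆ W ∧ D ⊆ W ∧ E ⊆ W)
    (hA : SetConnected r A) (hB : SetConnected r B) (hC : SetConnected r C)
    (hD : SetConnected r D) (hE : SetConnected r E)
    (hd : Disjoint A B ∧ Disjoint A C ∧ Disjoint A D ∧ Disjoint A E ∧ Disjoint B C ∧
      Disjoint B D ∧ Disjoint B E ∧ Disjoint C D ∧ Disjoint C E ∧ Disjoint D E)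
    (hAB : Touches r A B) (hAC : Touches r A C) (hAD : Touches r A D) (hAE : Touches r A E)
    (hBC : Touches r B C) (hDE : Touches r D E)
    (hn : ¬ Touches r B D ∧ ¬ Touches r B E ∧ ¬ Touches r C D ∧ ¬ Touches r C E) : False := by
  refine not_rankTwoColoring_bowtie
    (h.of_blocks (s := bowtie) hr (by decide) ![A, B, C, D, E] ?_ ?_)
  · simp [Fin.forall_fin_succ, *]
  · simp [Fin.forall_fin_succ, *]
    decide

theorem setConnected_singleton (x : N) : SetConnected r {x} := by
  refine ⟨singleton_nonempty x, fun T hT hne hTS => ?_⟩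
  rcases subset_singleton_iff.1 (mem_powerset.1 hT) with rfl | rfl
  · simp at hne
  · simp at hTS

theorem SetConnected.insert (hr : ∀ i j, r i j → r j i) {S : Finset N} (hS : SetConnected r S)
    {x y : N} (hy : y ∈ S) (hxy : r x y) : SetConnected r (insert x S) := by
  refine ⟨insert_nonempty _ _, fun T hT hne hTS => ?_⟩
  rw [mem_powerset] at hT
  by_cases hTS' : (T ∩ S).Nonempty ∧ T ∩ S ≠ S
  · obtain ⟨i, hi, j, hj, hij⟩ := hS.2 _ (mem_powerset.2 inter_subset_right) hTS'.1 hTS'.2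
    exact ⟨i, by grind, j, by grind, hij⟩
  have hST : ∀ t ∈ S, t ∈ T → S ⊆ T := fun t ht htT => by
    rw [not_and, not_not] at hTS'
    exact inter_eq_right.1 (hTS' ⟨t, mem_inter.2 ⟨htT, ht⟩⟩)
  by_cases hx : x ∈ T
  · have hyT : y ∉ T := fun hyT => hTS (hT.antisymm (insert_subset hx (hST y hy hyT)))
    exact ⟨x, hx, y, by grind, hxy⟩
  · obtain ⟨t, ht⟩ := hne
    have hyT : y ∈ T := hST t (by grind) ht hy
    exact ⟨y, hyT, x, by grind, hr _ _ hxy⟩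

theorem setConnected_pair (hr : ∀ i j, r i j → r j i) {x y : N} (hxy : r x y) :
    SetConnected r {x, y} :=
  (setConnected_singleton y).insert hr (mem_singleton_self y) hxy

/-- If no pair leaves `T`, then membership in `T` is constant along consecutive integers. -/
theorem setConnected_Icc {r : ℕ → ℕ → Prop} (hr : ∀ i j, r i j → r j i) {a b : ℕ} (hab : a ≤ b)
    (h : ∀ t, a ≤ t → t < b → r t (t + 1)) : SetConnected r (Icc a b) := by
  refine ⟨nonempty_Icc.2 hab, fun T hT hne hTS => ?_⟩
  rw [mem_powerset] at hT
  by_contra! hno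
  have hup : ∀ t, a ≤ t → t < b → (t ∈ T ↔ t + 1 ∈ T) := by
    intro t hat htb
    by_contra hiff
    by_cases ht : t ∈ T
    · exact hno t ht (t + 1) (by simp; grind) (h t hat htb)
    · exact hno (t + 1) (by tauto) t (by simp; grind) (hr _ _ (h t hat htb))
  have hall : ∀ d, a + d ≤ b → (a + d ∈ T ↔ a ∈ T) := by
    intro d
    induction d with
    | zero => simp
    | succ d ih => intro hd; rw [← ih (by omega), hup (a + d) (by omega) (by omega)]; rfl
  have hall' : ∀ t ∈ Icc a b, (t ∈ T ↔ a ∈ T) := by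
    intro t ht
    rw [mem_Icc] at ht
    have := hall (t - a) (by omega)
    rwa [Nat.add_sub_cancel' ht.1] at this
  obtain ⟨x, hx⟩ := hne
  have haT := (hall' x (hT hx)).1 hx
  exact hTS (hT.antisymm fun t ht => (hall' t ht).2 haT)

end Obstructions

/-! ### Attaching one vertex -/

section Extensions

/-- Adjacency of the path on `ℕ`. -/
def pathRel (i j : ℕ) : Prop := i + 1 = j ∨ j + 1 = i

/-- Adjacency of the path `0, …, n - 1` together with the vertex `n` joined to `0` and `1`. -/
def triangleRel (n i j : ℕ) : Prop :=
  i + 1 = j ∧ j < n ∨ j + 1 = i ∧ i < n ∨ i = n ∧ j < 2 ∨ j = n ∧ i < 2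

/-- The relation `r` on `0, …, n - 1` together with a new element `n` related to the elements
of `S`. -/
def attach (r : ℕ → ℕ → Prop) (n : ℕ) (S : ℕ → Prop) (i j : ℕ) : Prop :=
  i = n ∧ j < n ∧ S j ∨ j = n ∧ i < n ∧ S i ∨ i < n ∧ j < n ∧ r i j

variable {α : Type*} {c : Finset ℕ → α} {n : ℕ} {S : ℕ → Prop}

theorem attach_symm {r : ℕ → ℕ → Prop} (hr : ∀ i j, r i j → r j i) (i j : ℕ) :
    attach r n S i j → attach r n S j i := by
  unfold attach
  have := hr i j
  tauto

theorem pathRel_symm (i j : ℕ) : pathRel i j → pathRel j i := by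
  unfold pathRel; omega

theorem triangleRel_symm (i j : ℕ) : triangleRel n i j → triangleRel n j i := by
  unfold triangleRel; omega

/-- Two neighbours of the new vertex at distance at least two on the path close a cycle through it.
With a further neighbour `k` strictly between, contracting both sides of `k` gives a diamond;
without one, contracting the interior gives a 4-cycle. -/
theorem le_succ_of_attach_path (h : RankTwoColoring (attach pathRel n S) (range (n + 1)) c)
    {i j : ℕ} (hj : j < n) (hi : S i) (hSj : S j) : j ≤ i + 1 := by
  by_contra! hij
  have hr := attach_symm (n := n) (S := S) pathRel_symm
  by_cases hk : ∃ k, i < k ∧ k < j ∧ S k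
  · obtain ⟨k, hik, hkj, hk⟩ := hk
    refine h.not_diamond hr (A := {n}) (B := Icc i (k - 1)) (C := {k}) (D := Icc (k + 1) j)
      (by grind) (setConnected_singleton _)
      (setConnected_Icc hr (by omega) (by grind [attach, pathRel])) (setConnected_singleton _)
      (setConnected_Icc hr (by omega) (by grind [attach, pathRel]))
      (by simp only [disjoint_left]; grind)
      ⟨n, by grind, i, by grind, by grind [attach]⟩ ⟨n, by grind, k, by grind, by grind [attach]⟩
      ⟨n, by grind, j, by grind, by grind [attach]⟩
      ⟨k - 1, by grind, k, by grind, by grind [attach, pathRel]⟩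
      ⟨k, by grind, k + 1, by grind, by grind [attach, pathRel]⟩ ?_
    rintro ⟨u, hu, v, hv, huv⟩
    grind [attach, pathRel]
  · push Not at hk
    refine h.not_cycleFour hr (A := {n}) (B := {i}) (C := Icc (i + 1) (j - 1)) (D := {j})
      (by grind) (setConnected_singleton _) (setConnected_singleton _)
      (setConnected_Icc hr (by omega) (by grind [attach, pathRel])) (setConnected_singleton _)
      (by simp only [disjoint_left]; grind)
      ⟨n, by grind, i, by grind, by grind [attach]⟩
      ⟨i, by grind, i + 1, by grind, by grind [attach, pathRel]⟩
      ⟨j - 1, by grind, j, by grind, by grind [attach, pathRel]⟩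
      ⟨n, by grind, j, by grind, by grind [attach]⟩ ⟨?_, ?_⟩
    · rintro ⟨u, hu, v, hv, huv⟩
      grind [attach]
    · rintro ⟨u, hu, v, hv, huv⟩
      grind [attach, pathRel]

/-- The ways to attach a vertex to a path without creating an obstruction. -/
theorem attach_path_cases (h : RankTwoColoring (attach pathRel n S) (range (n + 1)) c)
    (hne : ∃ i < n, S i) :
    (∀ j < n, S j ↔ j = 0) ∨ (∀ j < n, S j ↔ j + 1 = n) ∨
      (2 ≤ n ∧ ∀ j < n, S j ↔ j < 2) ∨ (2 ≤ n ∧ ∀ j < n, S j ↔ n ≤ j + 2) := by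
  have hr := attach_symm (n := n) (S := S) pathRel_symm
  -- With `i` the least neighbour, the neighbourhood is `{i}` or `{i, i + 1}`.
  obtain ⟨i, ⟨hin, hi⟩, hmin⟩ : ∃ i, (i < n ∧ S i) ∧ ∀ j < i, ¬ (j < n ∧ S j) := by
    classical
    exact ⟨Nat.find hne, Nat.find_spec hne, fun j hj => Nat.find_min hne hj⟩
  have hle : ∀ j < n, S j → i ≤ j ∧ j ≤ i + 1 := fun j hj hSj =>
    ⟨by by_contra! hlt; exact hmin j hlt ⟨hj, hSj⟩, le_succ_of_attach_path h hj hi hSj⟩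
  by_cases hi1 : i + 1 < n ∧ S (i + 1)
  · have hS : ∀ j < n, S j ↔ j = i ∨ j = i + 1 := fun j hj => by
      refine ⟨fun hSj => by have := hle j hj hSj; omega, ?_⟩
      rintro (rfl | rfl)
      exacts [hi, hi1.2]
    rcases Nat.eq_zero_or_pos i with h0 | h0
    · exact .inr (.inr (.inl ⟨by omega, fun j hj => by rw [hS j hj]; omega⟩))
    by_cases h2 : i + 2 = n
    · exact .inr (.inr (.inr ⟨by omega, fun j hj => by rw [hS j hj]; omega⟩))
    -- A triangle on an interior edge of the path becomes a claw when that edge is contracted.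
    refine (h.not_claw hr (A := {i, i + 1}) (B := {n}) (C := {i - 1}) (D := {i + 2})
      (by grind) (setConnected_pair hr (by grind [attach, pathRel])) (setConnected_singleton _)
      (setConnected_singleton _) (setConnected_singleton _) (by simp only [disjoint_left]; grind)
      ⟨i, by grind, n, by grind, by grind [attach]⟩
      ⟨i, by grind, i - 1, by grind, by grind [attach, pathRel]⟩
      ⟨i + 1, by grind, i + 2, by grind, by grind [attach, pathRel]⟩ ⟨?_, ?_, ?_⟩).elim
    all_goals
      rintro ⟨u, hu, v, hv, huv⟩
      grind [attach, pathRel]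
  · have hS : ∀ j < n, S j ↔ j = i := fun j hj => by
      refine ⟨fun hSj => ?_, fun e => e ▸ hi⟩
      have := hle j hj hSj
      by_contra hji
      have : j = i + 1 := by omega
      subst this
      exact hi1 ⟨hj, hSj⟩
    rcases Nat.eq_zero_or_pos i with h0 | h0
    · exact .inl fun j hj => by rw [hS j hj]; omega
    by_cases h2 : i + 1 = n
    · exact .inr (.inl fun j hj => by rw [hS j hj]; omega)
    refine (h.not_claw hr (A := {i}) (B := {n}) (C := {i - 1}) (D := {i + 1})
      (by grind) (setConnected_singleton _) (setConnected_singleton _)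
      (setConnected_singleton _) (setConnected_singleton _) (by simp only [disjoint_left]; grind)
      ⟨i, by grind, n, by grind, by grind [attach]⟩
      ⟨i, by grind, i - 1, by grind, by grind [attach, pathRel]⟩
      ⟨i, by grind, i + 1, by grind, by grind [attach, pathRel]⟩ ⟨?_, ?_, ?_⟩).elim
    all_goals
      rintro ⟨u, hu, v, hv, huv⟩
      grind [attach, pathRel]

/-- A vertex attached to a triangle without creating an obstruction has one neighbour. -/
theorem attach_triangle_cases (h : RankTwoColoring (attach (triangleRel 2) 3 S) (range 4) c)
    (hne : ∃ i < 3, S i) : ∃ i < 3, ∀ j < 3, S j ↔ j = i := by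
  have hr := attach_symm (n := 3) (S := S) (triangleRel_symm (n := 2))
  obtain ⟨i, hi, hSi⟩ := hne
  refine ⟨i, hi, fun j hj => ⟨fun hSj => ?_, fun e => e ▸ hSi⟩⟩
  by_contra hij
  -- The labels `0, 1, 2` sum to `3`, so `3 - i - j` is the third vertex of the triangle.
  by_cases hk : S (3 - i - j)
  · exact h.not_completeFour hr (A := {i}) (B := {j}) (C := {3 - i - j}) (D := {3})
      (by grind) (setConnected_singleton _) (setConnected_singleton _)
      (setConnected_singleton _) (setConnected_singleton _) (by simp only [disjoint_left]; grind)
      ⟨i, by grind, j, by grind, by grind [attach, triangleRel]⟩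
      ⟨i, by grind, 3 - i - j, by grind, by grind [attach, triangleRel]⟩
      ⟨i, by grind, 3, by grind, by grind [attach]⟩
      ⟨j, by grind, 3 - i - j, by grind, by grind [attach, triangleRel]⟩
      ⟨j, by grind, 3, by grind, by grind [attach]⟩
      ⟨3 - i - j, by grind, 3, by grind, by grind [attach]⟩
  · refine h.not_diamond hr (A := {i}) (B := {3 - i - j}) (C := {j}) (D := {3})
      (by grind) (setConnected_singleton _) (setConnected_singleton _)
      (setConnected_singleton _) (setConnected_singleton _) (by simp only [disjoint_left]; grind)
      ⟨i, by grind, 3 - i - j, by grind, by grind [attach, triangleRel]⟩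
      ⟨i, by grind, j, by grind, by grind [attach, triangleRel]⟩
      ⟨i, by grind, 3, by grind, by grind [attach]⟩
      ⟨3 - i - j, by grind, j, by grind, by grind [attach, triangleRel]⟩
      ⟨j, by grind, 3, by grind, by grind [attach]⟩ ?_
    rintro ⟨u, hu, v, hv, huv⟩
    grind [attach]

/-- A vertex attached to a triangle with a pendant path without creating an obstruction extends
the path. -/
theorem attach_pathWithTriangle_cases (hn : 3 ≤ n)
    (h : RankTwoColoring (attach (triangleRel n) (n + 1) S) (range (n + 2)) c)
    (hne : ∃ i < n + 1, S i) : ∀ j < n + 1, S j ↔ j + 1 = n := by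
  have hr := attach_symm (n := n + 1) (S := S) (triangleRel_symm (n := n))
  by_cases hne' : ∃ i < n, S i
  swap
  -- Here the new vertex hangs on the apex alone; contracting the edge `{1, n}` of the triangle
  -- gives a claw.
  · have hSn : S n := by grind
    refine (h.not_claw hr (A := {1, n}) (B := {0}) (C := {2}) (D := {n + 1})
      (by grind) (setConnected_pair hr (by grind [attach, triangleRel])) (setConnected_singleton _)
      (setConnected_singleton _) (setConnected_singleton _) (by simp only [disjoint_left]; grind)
      ⟨1, by grind, 0, by grind, by grind [attach, triangleRel]⟩
      ⟨1, by grind, 2, by grind, by grind [attach, triangleRel]⟩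
      ⟨n, by grind, n + 1, by grind, by grind [attach, triangleRel]⟩ ⟨?_, ?_, ?_⟩).elim
    all_goals
      rintro ⟨u, hu, v, hv, huv⟩
      grind [attach, triangleRel]
  -- Deleting the apex `n` leaves the new vertex attached to the path `0, …, n - 1`, so its
  -- neighbours there are restricted to the four path cases. Each is then combined with whether it
  -- touches the apex.
  have hpath := h.contract (s := attach pathRel n S) (U := range (n + 1))
    (f := fun i => if i = n then {n + 1} else {i}) (fun i hi => by grind)
    (fun i hi => by split_ifs <;> exact setConnected_singleton _)
    (fun i hi j hj u hu hv => by grind)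
    (fun i hi j hj hij => by
      rw [mem_range] at hi hj
      by_cases h1 : i = n
      · have h2 : j ≠ n := by omega
        simp [h1, h2, attach]
        grind
      · by_cases h2 : j = n
        · simp [h1, h2, attach]
          grind
        · simp [h1, h2, attach, pathRel, triangleRel]
          grind)
  by_cases hSn : S n
  · exfalso
    rcases attach_path_cases hpath hne' with hS | hS | ⟨-, hS⟩ | ⟨-, hS⟩
    · refine h.not_diamond hr (A := {0}) (B := {1}) (C := {n}) (D := {n + 1})
        (by grind) (setConnected_singleton _) (setConnected_singleton _)
        (setConnected_singleton _) (setConnected_singleton _) (by simp only [disjoint_left]; grind)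
        ⟨0, by grind, 1, by grind, by grind [attach, triangleRel]⟩
        ⟨0, by grind, n, by grind, by grind [attach, triangleRel]⟩
        ⟨0, by grind, n + 1, by grind, by grind [attach]⟩
        ⟨1, by grind, n, by grind, by grind [attach, triangleRel]⟩
        ⟨n, by grind, n + 1, by grind, by grind [attach]⟩ ?_
      rintro ⟨u, hu, v, hv, huv⟩
      grind [attach]
    · refine h.not_cycleFour hr (A := {n}) (B := {1}) (C := Icc 2 (n - 1)) (D := {n + 1})
        (by grind) (setConnected_singleton _) (setConnected_singleton _)
        (setConnected_Icc hr (by omega) (by grind [attach, triangleRel]))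
        (setConnected_singleton _) (by simp only [disjoint_left]; grind)
        ⟨n, by grind, 1, by grind, by grind [attach, triangleRel]⟩
        ⟨1, by grind, 2, by grind, by grind [attach, triangleRel]⟩
        ⟨n - 1, by grind, n + 1, by grind, by grind [attach]⟩
        ⟨n, by grind, n + 1, by grind, by grind [attach]⟩ ⟨?_, ?_⟩
      · rintro ⟨u, hu, v, hv, huv⟩
        grind [attach, triangleRel]
      · rintro ⟨u, hu, v, hv, huv⟩
        grind [attach]
    · exact h.not_completeFour hr (A := {0}) (B := {1}) (C := {n}) (D := {n + 1})
        (by grind) (setConnected_singleton _) (setConnected_singleton _)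
        (setConnected_singleton _) (setConnected_singleton _) (by simp only [disjoint_left]; grind)
        ⟨0, by grind, 1, by grind, by grind [attach, triangleRel]⟩
        ⟨0, by grind, n, by grind, by grind [attach, triangleRel]⟩
        ⟨0, by grind, n + 1, by grind, by grind [attach]⟩
        ⟨1, by grind, n, by grind, by grind [attach, triangleRel]⟩
        ⟨1, by grind, n + 1, by grind, by grind [attach]⟩
        ⟨n, by grind, n + 1, by grind, by grind [attach]⟩
    · by_cases h3 : n = 3
      · refine h.not_diamond hr (A := {1}) (B := {0}) (C := {n}) (D := {n + 1})
          (by grind) (setConnected_singleton _) (setConnected_singleton _)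
          (setConnected_singleton _) (setConnected_singleton _)
          (by simp only [disjoint_left]; grind)
          ⟨1, by grind, 0, by grind, by grind [attach, triangleRel]⟩
          ⟨1, by grind, n, by grind, by grind [attach, triangleRel]⟩
          ⟨1, by grind, n + 1, by grind, by grind [attach]⟩
          ⟨0, by grind, n, by grind, by grind [attach, triangleRel]⟩
          ⟨n, by grind, n + 1, by grind, by grind [attach]⟩ ?_
        rintro ⟨u, hu, v, hv, huv⟩
        grind [attach]
      -- For `n ≥ 4` the neighbours `n - 2` and `n - 1` both lie in the contracted tail, so the new
      -- vertex misses `1`.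
      · refine h.not_cycleFour hr (A := {n}) (B := {1}) (C := Icc 2 (n - 1)) (D := {n + 1})
          (by grind) (setConnected_singleton _) (setConnected_singleton _)
          (setConnected_Icc hr (by omega) (by grind [attach, triangleRel]))
          (setConnected_singleton _) (by simp only [disjoint_left]; grind)
          ⟨n, by grind, 1, by grind, by grind [attach, triangleRel]⟩
          ⟨1, by grind, 2, by grind, by grind [attach, triangleRel]⟩
          ⟨n - 1, by grind, n + 1, by grind, by grind [attach]⟩
          ⟨n, by grind, n + 1, by grind, by grind [attach]⟩ ⟨?_, ?_⟩
        · rintro ⟨u, hu, v, hv, huv⟩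
          grind [attach, triangleRel]
        · rintro ⟨u, hu, v, hv, huv⟩
          grind [attach]
  · rcases attach_path_cases hpath hne' with hS | hS | ⟨-, hS⟩ | ⟨-, hS⟩
    · refine (h.not_claw hr (A := {0, 1}) (B := {n}) (C := {2}) (D := {n + 1})
        (by grind) (setConnected_pair hr (by grind [attach, triangleRel]))
        (setConnected_singleton _) (setConnected_singleton _) (setConnected_singleton _)
        (by simp only [disjoint_left]; grind)
        ⟨0, by grind, n, by grind, by grind [attach, triangleRel]⟩
        ⟨1, by grind, 2, by grind, by grind [attach, triangleRel]⟩
        ⟨0, by grind, n + 1, by grind, by grind [attach]⟩ ⟨?_, ?_, ?_⟩).elim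
      all_goals
        rintro ⟨u, hu, v, hv, huv⟩
        grind [attach, triangleRel]
    · grind
    · refine (h.not_diamond hr (A := {0}) (B := {n}) (C := {1}) (D := {n + 1})
        (by grind) (setConnected_singleton _) (setConnected_singleton _)
        (setConnected_singleton _) (setConnected_singleton _) (by simp only [disjoint_left]; grind)
        ⟨0, by grind, n, by grind, by grind [attach, triangleRel]⟩
        ⟨0, by grind, 1, by grind, by grind [attach, triangleRel]⟩
        ⟨0, by grind, n + 1, by grind, by grind [attach]⟩
        ⟨n, by grind, 1, by grind, by grind [attach, triangleRel]⟩
        ⟨1, by grind, n + 1, by grind, by grind [attach]⟩ ?_).elim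
      rintro ⟨u, hu, v, hv, huv⟩
      grind [attach]
    -- Contracting the path between the two end triangles gives the bowtie.
    · refine (h.not_bowtie hr (A := Icc 1 (n - 2)) (B := {0}) (C := {n}) (D := {n - 1})
        (E := {n + 1}) (by grind)
        (setConnected_Icc hr (by omega) (by grind [attach, triangleRel]))
        (setConnected_singleton _) (setConnected_singleton _)
        (setConnected_singleton _) (setConnected_singleton _) (by simp only [disjoint_left]; grind)
        ⟨1, by grind, 0, by grind, by grind [attach, triangleRel]⟩
        ⟨1, by grind, n, by grind, by grind [attach, triangleRel]⟩
        ⟨n - 2, by grind, n - 1, by grind, by grind [attach, triangleRel]⟩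
        ⟨n - 2, by grind, n + 1, by grind, by grind [attach]⟩
        ⟨0, by grind, n, by grind, by grind [attach, triangleRel]⟩
        ⟨n - 1, by grind, n + 1, by grind, by grind [attach]⟩ ⟨?_, ?_, ?_, ?_⟩).elim
      all_goals
        rintro ⟨u, hu, v, hv, huv⟩
        grind [attach, triangleRel]

end Extensions

/-! ### Labelled graphs and the extension step -/

section Labelings

variable {N : Type*} {G : SimpleGraph N} {m : ℕ} {r : ℕ → ℕ → Prop} {p : ℕ → N}

/-- `p` labels the vertices of `G` by `0, …, m - 1` such that adjacency becomes the relation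
`r`. -/
structure IsLabeling (G : SimpleGraph N) (m : ℕ) (r : ℕ → ℕ → Prop) (p : ℕ → N) : Prop where
  inj : ∀ i < m, ∀ j < m, p i = p j → i = j
  surj : ∀ x, ∃ i < m, p i = x
  adj : ∀ i < m, ∀ j < m, G.Adj (p i) (p j) ↔ r i j

theorem IsLabeling.relabel (h : IsLabeling G m r p) (r' : ℕ → ℕ → Prop) (σ τ : ℕ → ℕ)
    (hσ : ∀ i < m, σ i < m ∧ τ (σ i) = i) (hτ : ∀ i < m, τ i < m ∧ σ (τ i) = i)
    (hr : ∀ i < m, ∀ j < m, r (σ i) (σ j) ↔ r' i j) : IsLabeling G m r' (p ∘ σ) where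
  inj i hi j hj hij := by
    rw [← (hσ i hi).2, ← (hσ j hj).2, h.inj _ (hσ i hi).1 _ (hσ j hj).1 hij]
  surj x := by
    obtain ⟨i, hi, rfl⟩ := h.surj x
    exact ⟨τ i, (hτ i hi).1, congrArg p (hτ i hi).2⟩
  adj i hi j hj := by
    rw [← hr i hi j hj]
    exact h.adj _ (hσ i hi).1 _ (hσ j hj).1

theorem IsLabeling.nonempty_iso (h : IsLabeling G m r p) (H : SimpleGraph (Fin m))
    (hH : ∀ i j : Fin m, H.Adj i j ↔ r i j) : Nonempty (G ≃g H) := by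
  have hbij : Function.Bijective fun i : Fin m => p i :=
    ⟨fun i j hij => Fin.ext (h.inj _ i.2 _ j.2 hij), fun x => by
      obtain ⟨i, hi, rfl⟩ := h.surj x
      exact ⟨⟨i, hi⟩, rfl⟩⟩
  let e : H ≃g G := ⟨Equiv.ofBijective _ hbij, fun {i j} => by
    rw [hH]; exact h.adj _ i.2 _ j.2⟩
  exact ⟨e.symm⟩

theorem IsLabeling.rankTwoColoring [Fintype N] [DecidableEq N] {α : Type*} {c : Finset N → α}
    (h : IsLabeling G m r p) (hc : RankTwoColoring G.Adj univ c) :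
    RankTwoColoring r (range m) fun S => c (S.biUnion fun i => {p i}) :=
  hc.contract (fun _ _ => subset_univ _) (fun _ _ => setConnected_singleton _)
    (fun i hi j hj u hui huj => h.inj i (mem_range.1 hi) j (mem_range.1 hj)
      ((mem_singleton.1 hui).symm.trans (mem_singleton.1 huj)))
    (fun i hi j hj _ => by simp [h.adj i (mem_range.1 hi) j (mem_range.1 hj)])

theorem IsLabeling.attach {v : N} {q : ℕ → ({v}ᶜ : Set N)}
    (h : IsLabeling (G.induce {v}ᶜ) m r q) :
    IsLabeling G (m + 1) (attach r m fun i => G.Adj v (q i))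
      (fun i => if i < m then (q i : N) else v) where
  inj i hi j hj hij := by
    have hv : ∀ i, (q i : N) ≠ v := fun i => (q i).2
    by_cases h1 : i < m <;> by_cases h2 : j < m <;> simp only [h1, h2, if_true, if_false] at hij
    · exact h.inj i h1 j h2 (Subtype.ext hij)
    · exact absurd hij (hv i)
    · exact absurd hij.symm (hv j)
    · omega
  surj x := by
    by_cases hx : x = v
    · exact ⟨m, by omega, by simp [hx]⟩
    · obtain ⟨i, hi, hix⟩ := h.surj ⟨x, hx⟩
      exact ⟨i, by omega, by simp [hi, hix]⟩
  adj i hi j hj := by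
    by_cases h1 : i < m <;> by_cases h2 : j < m <;> simp only [h1, h2, if_true, if_false]
    · have := h.adj i h1 j h2
      simp only [SimpleGraph.comap_adj, Function.Embedding.subtype_apply] at this
      simp [ConnectedSubgraph.attach, this, h1, h2, h1.ne, h2.ne]
    · have : j = m := by omega
      subst this
      simp [ConnectedSubgraph.attach, h1, h1.ne, G.adj_comm]
    · have : i = m := by omega
      subst this
      simp [ConnectedSubgraph.attach, h2, h2.ne]
    · have : i = m := by omega
      have : j = m := by omega
      subst i j
      simp [ConnectedSubgraph.attach]

theorem exists_labeling_of_attach_path {n : ℕ} {S : ℕ → Prop} {α : Type*} {c : Finset ℕ → α}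
    (h : IsLabeling G (n + 1) (attach pathRel n S) p)
    (hc : RankTwoColoring (attach pathRel n S) (range (n + 1)) c) (hne : ∃ i < n, S i) :
    (∃ q, IsLabeling G (n + 1) pathRel q) ∨
      (2 ≤ n ∧ ∃ q, IsLabeling G (n + 1) (triangleRel n) q) := by
  rcases attach_path_cases hc hne with hS | hS | ⟨h2, hS⟩ | ⟨h2, hS⟩
  -- The new vertex `n` precedes `0`, so the labels are rotated.
  · refine .inl ⟨_, h.relabel pathRel (fun i => if i = 0 then n else i - 1)
      (fun i => if i = n then 0 else i + 1) (by grind) (by grind) fun i hi j hj => ?_⟩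
    grind [ConnectedSubgraph.attach, pathRel]
  · refine .inl ⟨_, h.relabel pathRel id id (by grind) (by grind) fun i hi j hj => ?_⟩
    grind [ConnectedSubgraph.attach, pathRel]
  · refine .inr ⟨h2, _, h.relabel (triangleRel n) id id (by grind) (by grind) fun i hi j hj => ?_⟩
    grind [ConnectedSubgraph.attach, pathRel, triangleRel]
  -- The triangle sits at the far end, so the path is reversed with the apex fixed.
  · refine .inr ⟨h2, _, h.relabel (triangleRel n) (fun i => if i = n then n else n - 1 - i)
      (fun i => if i = n then n else n - 1 - i) (by grind) (by grind) fun i hi j hj => ?_⟩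
    have hi' := hS (n - 1 - i)
    have hj' := hS (n - 1 - j)
    by_cases h3 : i = n <;> by_cases h4 : j = n <;>
      simp only [ConnectedSubgraph.attach, pathRel, triangleRel, h3, h4, if_true, if_false] <;>
      grind

theorem exists_labeling_of_attach_triangle {n : ℕ} {S : ℕ → Prop} {α : Type*} {c : Finset ℕ → α}
    (hn : 2 ≤ n) (h : IsLabeling G (n + 2) (attach (triangleRel n) (n + 1) S) p)
    (hc : RankTwoColoring (attach (triangleRel n) (n + 1) S) (range (n + 2)) c)
    (hne : ∃ i < n + 1, S i) : ∃ q, IsLabeling G (n + 2) (triangleRel (n + 1)) q := by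
  rcases hn.eq_or_lt with rfl | hn
  · obtain ⟨i, hi, hS⟩ := attach_triangle_cases hc hne
    refine ⟨_, h.relabel (triangleRel 3)
      -- The neighbour `i` of the pendant vertex becomes vertex `1`, the pendant vertex becomes `2`,
      -- and the other two triangle vertices become `0` and the apex `3`.
      (fun j => if j = 0 then (i + 1) % 3 else if j = 1 then i else if j = 2 then 3 else (i + 2) % 3)
      (fun j => if j = 3 then 2 else if j = i then 1 else if j = (i + 1) % 3 then 0 else 3)
      ?_ ?_ fun a ha b hb => ?_⟩
    · interval_cases i <;> decide
    · interval_cases i <;> decide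
    · have h0 := hS 0 (by omega)
      have h1 := hS 1 (by omega)
      have h2 := hS 2 (by omega)
      interval_cases i <;> interval_cases a <;> interval_cases b <;>
        simp [ConnectedSubgraph.attach, triangleRel, h0, h1, h2]
  · have hS := attach_pathWithTriangle_cases hn hc hne
    -- The new vertex extends the path, so it exchanges labels with the apex.
    refine ⟨_, h.relabel (triangleRel (n + 1))
      (fun i => if i = n then n + 1 else if i = n + 1 then n else i)
      (fun i => if i = n then n + 1 else if i = n + 1 then n else i) (by grind) (by grind)
      fun i hi j hj => ?_⟩
    grind [ConnectedSubgraph.attach, triangleRel]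

end Labelings

/-- Induction on the number of vertices. The colouring is quantified inside because the
vertex-deleted graph carries a restricted one. -/
theorem exists_labeling_of_rankTwoColoring {α : Type*} (m : ℕ) :
    ∀ {N : Type*} [Fintype N] [DecidableEq N] (G : SimpleGraph N) (c : Finset N → α),
      Fintype.card N = m → G.Connected → RankTwoColoring G.Adj univ c →
      (1 ≤ m ∧ ∃ p, IsLabeling G m pathRel p) ∨
        ∃ n, m = n + 1 ∧ 2 ≤ n ∧ ∃ p, IsLabeling G (n + 1) (triangleRel n) p := by
  induction m with
  | zero =>
    intro N _ _ G c hN hG _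
    have := hG.nonempty
    exact absurd hN Fintype.card_ne_zero
  | succ m ih =>
    intro N _ _ G c hN hG hc
    rcases Nat.eq_zero_or_pos m with rfl | hm
    · obtain ⟨x, hx⟩ := Fintype.card_eq_one_iff.1 hN
      exact .inl ⟨le_rfl, fun _ => x, by grind, fun y => ⟨0, by simp [hx y]⟩, fun i hi j hj => by
        simp [pathRel]; omega⟩
    have : Nontrivial N := Fintype.one_lt_card_iff_nontrivial.1 (by omega)
    -- A non-cut vertex exists, so the induction hypothesis applies to its complement.
    obtain ⟨v, hv⟩ := hG.exists_connected_induce_compl_singleton_of_finite_nontrivial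
    have hcard : Fintype.card ({v}ᶜ : Set N) = m := by
      rw [← Set.toFinset_card, Set.toFinset_compl, Set.toFinset_singleton, card_compl, hN]; simp
    obtain ⟨w, hw⟩ := hG.preconnected.exists_adj_of_nontrivial v
    have hne : ∀ {k} {r : ℕ → ℕ → Prop} {q : ℕ → ({v}ᶜ : Set N)},
        IsLabeling (G.induce {v}ᶜ) k r q → ∃ i < k, G.Adj v (q i) := fun {k r q} hq => by
      obtain ⟨i, hi, hiw⟩ := hq.surj ⟨w, hw.ne'⟩
      exact ⟨i, hi, by rwa [hiw]⟩
    have hc' := hc.contract (s := (G.induce {v}ᶜ).Adj) (U := univ)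
      (f := fun x : ({v}ᶜ : Set N) => {x.1}) (fun _ _ => subset_univ _)
      (fun _ _ => setConnected_singleton _)
      (fun i _ j _ u hui huj => Subtype.ext
        ((mem_singleton.1 hui).symm.trans (mem_singleton.1 huj)))
      (fun i _ j _ _ => by simp)
    rcases ih (G.induce {v}ᶜ) _ hcard hv hc' with ⟨_, q, hq⟩ | ⟨n, rfl, hn, q, hq⟩
    · have hp := hq.attach
      rcases exists_labeling_of_attach_path hp (hp.rankTwoColoring hc) (hne hq) with h | ⟨h2, h⟩
      · exact .inl ⟨by omega, h⟩
      · exact .inr ⟨m, rfl, h2, h⟩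
    · have hp := hq.attach
      exact .inr ⟨n + 1, rfl, by omega,
        exists_labeling_of_attach_triangle hn hp (hp.rankTwoColoring hc) (hne hq)⟩

theorem pathGraph_adj_iff_pathRel {n : ℕ} (i j : Fin n) :
    (SimpleGraph.pathGraph n).Adj i j ↔ pathRel i j := by
  rw [SimpleGraph.pathGraph_adj, pathRel]

theorem pathWithTriangle_adj_iff {n : ℕ} (hn : 2 ≤ n) (i j : Fin (n + 1)) :
    (pathWithTriangle n 1).Adj i j ↔ triangleRel n i j := by
  simp only [pathWithTriangle, SimpleGraph.fromRel_adj, triangleRel, ne_eq, Fin.ext_iff]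
  omega

theorem isoClass_of_isFactored {N : Type*} [Fintype N] {G : SimpleGraph N} (hG : G.Connected)
    (h : IsFactored (arrangement ℚ G)) :
    (∃ n : ℕ, Nonempty (G ≃g SimpleGraph.pathGraph n)) ∨
      ∃ n : ℕ, 2 ≤ n ∧ Nonempty (G ≃g pathWithTriangle n 1) := by
  classical
  obtain ⟨s, π, hπ⟩ := h
  rcases exists_labeling_of_rankTwoColoring _ G _ rfl hG
    (rankTwoColoring_of_isNicePartition hπ) with ⟨-, p, hp⟩ | ⟨n, -, hn, p, hp⟩
  · exact .inl ⟨_, hp.nonempty_iso _ pathGraph_adj_iff_pathRel⟩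
  · exact .inr ⟨n, hn, hp.nonempty_iso _ (pathWithTriangle_adj_iff hn)⟩

/-! ### Nice partitions from blocks of vertex sets -/

/-- A partition of the connected sets of `G` into blocks which defines a nice partition of the
arrangement. The set `X` stands for a flat. -/
structure NiceBlocks {N ι : Type*} [DecidableEq N] (G : SimpleGraph N)
    (B : ι → Set (Finset N)) : Prop where
  cover : ∀ I, SetConnected G.Adj I ↔ ∃ i, I ∈ B i
  disjoint : ∀ i j I, I ∈ B i → I ∈ B j → i = j
  nonempty : ∀ i, (B i).Nonempty
  independent : ∀ K : ι → Finset N, (∀ i, K i ∈ B i) →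
    ∀ x : N → ℚ, (∀ i, ∑ v ∈ K i, x v = 0) → x = 0
  singleton : ∀ X : Set (N → ℚ), (∃ i, ∃ I ∈ B i, ∀ x ∈ X, ∑ v ∈ I, x v = 0) →
    ∃ i, ∃ I ∈ B i, (∀ x ∈ X, ∑ v ∈ I, x v = 0) ∧
      ∀ J ∈ B i, (∀ x ∈ X, ∑ v ∈ J, x v = 0) → J = I

/-- Forms without a common nonzero root span the dual space. There are as many of them as its
dimension, so they are independent. -/
theorem NiceBlocks.isNicePartition {N ι : Type*} [DecidableEq N] [Fintype N] [Fintype ι]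
    {G : SimpleGraph N} {B : ι → Set (Finset N)} (h : NiceBlocks G B)
    (hcard : Fintype.card ι = Fintype.card N) :
    IsNicePartition (arrangement ℚ G) fun i => hyperplane ℚ '' B i := by
  have hle : ∀ {X : Submodule ℚ (N → ℚ)} {I : Finset N},
      X ≤ hyperplane ℚ I ↔ ∀ x ∈ (X : Set (N → ℚ)), ∑ v ∈ I, x v = 0 := fun {X I} =>
    ⟨fun h x hx => mem_hyperplane.1 (h hx), fun h x hx => mem_hyperplane.2 (h x hx)⟩
  constructor
  · constructor
    · exact fun i => (h.nonempty i).image _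
    · intro i j hij
      refine Set.disjoint_left.2 ?_
      rintro _ ⟨I, hI, rfl⟩ ⟨J, hJ, hIJ⟩
      exact hij (h.disjoint i j I hI (hyperplane_injective hIJ ▸ hJ))
    · ext H
      simp only [Set.mem_iUnion, Set.mem_image, mem_arrangement_iff, h.cover]
      constructor
      · rintro ⟨i, I, hI, rfl⟩
        exact ⟨I, ⟨i, hI⟩, rfl⟩
      · rintro ⟨I, ⟨i, hI⟩, rfl⟩
        exact ⟨i, I, hI, rfl⟩
  · intro a ha
    choose K hK hKa using ha
    have hker : ∀ x : N → ℚ, (∀ i, a i x = 0) → x = 0 := fun x hx =>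
      h.independent K hK x fun i => by
        rw [← mem_hyperplane, hKa i]; exact hx i
    refine linearIndependent_of_top_le_span_of_card_eq_finrank (fun f _ => ?_) ?_
    · refine mem_span_of_iInf_ker_le_ker (L := a) fun x hx => ?_
      rw [hker x fun i => (Submodule.mem_iInf _).1 hx i]
      exact zero_mem _
    · rw [Subspace.dual_finrank_eq, Module.finrank_fintype_fun_eq_card, hcard]
  · rintro X ⟨C, hC, rfl⟩ hX
    obtain ⟨H, hH⟩ : C.Nonempty := by
      by_contra hne
      exact hX (by rw [Set.not_nonempty_iff_eq_empty.1 hne, sInf_empty])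
    obtain ⟨I, hI, rfl⟩ := mem_arrangement_iff.1 (hC hH)
    obtain ⟨i, hi⟩ := (h.cover I).1 hI
    obtain ⟨i, J, hJ, hJX, hJu⟩ := h.singleton (sInf C : Submodule ℚ (N → ℚ))
      ⟨i, I, hi, hle.1 (sInf_le hH)⟩
    have heq : hyperplane ℚ '' B i ∩ localization (arrangement ℚ G) (sInf C) =
        {hyperplane ℚ J} := by
      ext H
      constructor
      · rintro ⟨⟨I', hI', rfl⟩, -, hle'⟩
        rw [hJu I' hI' (hle.1 hle'), Set.mem_singleton_iff]
      · rintro rfl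
        exact ⟨⟨J, hJ, rfl⟩, mem_arrangement_iff.2 ⟨J, (h.cover J).2 ⟨i, hJ⟩, rfl⟩, hle.2 hJX⟩
    exact ⟨_, ⟨heq ▸ Set.singleton_nonempty _, i, rfl⟩, _, heq⟩

theorem NiceBlocks.comap {M N ι : Type*} [DecidableEq M] [DecidableEq N] {G : SimpleGraph N}
    {H : SimpleGraph M} (e : N ≃ M) (he : ∀ i j, H.Adj (e i) (e j) ↔ G.Adj i j)
    {B : ι → Set (Finset M)} (h : NiceBlocks H B) :
    NiceBlocks G fun i => {I | I.map e.toEmbedding ∈ B i} := by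
  have hmap : ∀ J : Finset M, (J.map e.symm.toEmbedding).map e.toEmbedding = J :=
    fun J => by ext x; simp
  have hsum : ∀ (I : Finset N) (x : N → ℚ),
      ∑ v ∈ I.map e.toEmbedding, x (e.symm v) = ∑ v ∈ I, x v := fun I x => by simp
  constructor
  · intro I
    have := setConnected_biUnion_iff (r := H.Adj) (s := G.Adj) (U := I) (S := I)
      (f := fun v => {e v}) (fun _ _ => setConnected_singleton _)
      (fun i _ j _ u hui huj => e.injective
        ((mem_singleton.1 hui).symm.trans (mem_singleton.1 huj)))
      (fun i _ j _ _ => by simp [he]) subset_rfl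
    have hI : (I.biUnion fun v => {e v}) = I.map e.toEmbedding := by
      ext x
      simp only [mem_biUnion, mem_singleton, mem_map, Equiv.coe_toEmbedding, eq_comm]
    rw [← this, hI, h.cover]
    rfl
  · exact fun i j I hi hj => h.disjoint i j _ hi hj
  · intro i
    obtain ⟨J, hJ⟩ := h.nonempty i
    exact ⟨J.map e.symm.toEmbedding, by rwa [Set.mem_ofPred_eq, hmap]⟩
  · intro K hK x hx
    have := h.independent _ hK (fun v => x (e.symm v)) fun i => by rw [hsum]; exact hx i
    ext v
    simpa using congrFun this (e v)
  · rintro X ⟨i, I, hI, hX⟩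
    obtain ⟨j, J, hJ, hJX, hJu⟩ := h.singleton ((fun x v => x (e.symm v)) '' X)
      ⟨i, _, hI, by rintro _ ⟨x, hx, rfl⟩; rw [hsum]; exact hX x hx⟩
    refine ⟨j, J.map e.symm.toEmbedding, by rwa [Set.mem_ofPred_eq, hmap],
      fun x hx => ?_, fun I' hI' hI'X => ?_⟩
    · rw [← hsum, hmap]
      exact hJX _ ⟨x, hx, rfl⟩
    · rw [← hJu _ hI' (by rintro _ ⟨x, hx, rfl⟩; rw [hsum]; exact hI'X x hx)]
      ext x; simp

/-! ### Segments and partial sums -/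

section Segments

variable {m : ℕ}

/-- The elements `i, …, j - 1` of `Fin m`. -/
def seg (m i j : ℕ) : Finset (Fin m) := univ.filter fun v => i ≤ (v : ℕ) ∧ (v : ℕ) < j

@[simp, grind =]
theorem mem_seg {i j : ℕ} {v : Fin m} : v ∈ seg m i j ↔ i ≤ (v : ℕ) ∧ (v : ℕ) < j := by
  simp [seg]

theorem seg_injective {i j i' j' : ℕ} (hij : i < j) (hj : j ≤ m) (hij' : i' < j') (hj' : j' ≤ m)
    (h : seg m i j = seg m i' j') : i = i' ∧ j = j' := by
  have h1 := Finset.ext_iff.1 h ⟨i, by omega⟩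
  have h2 := Finset.ext_iff.1 h ⟨j - 1, by omega⟩
  have h3 := Finset.ext_iff.1 h ⟨i', by omega⟩
  have h4 := Finset.ext_iff.1 h ⟨j' - 1, by omega⟩
  simp only [mem_seg] at h1 h2 h3 h4
  omega

/-- In terms of partial sums `s_k`, the hyperplane of a segment is `s_j = s_i`. -/
theorem sum_seg {i j : ℕ} (hij : i ≤ j) (x : Fin m → ℚ) :
    ∑ v ∈ seg m i j, x v = ∑ v ∈ seg m 0 j, x v - ∑ v ∈ seg m 0 i, x v := by
  have : seg m 0 j = seg m 0 i ∪ seg m i j := by ext v; simp; omega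
  rw [this, sum_union (disjoint_left.2 fun v => by simp; omega)]
  ring

theorem sum_seg_zero (x : Fin m → ℚ) : ∑ v ∈ seg m 0 0, x v = 0 :=
  sum_eq_zero fun v hv => by simp at hv

theorem eq_sub_sum_seg (x : Fin m → ℚ) (v : Fin m) :
    x v = ∑ w ∈ seg m 0 (v + 1), x w - ∑ w ∈ seg m 0 v, x w := by
  have : seg m v (v + 1) = {v} := by ext w; simp [Fin.ext_iff]; omega
  rw [← sum_seg (by omega), this, sum_singleton]

theorem setConnected_seg {s : Fin m → Fin m → Prop} (hs : ∀ a b, s a b → s b a) {i j : ℕ}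
    (hij : i < j) (hj : j ≤ m)
    (h : ∀ a b : Fin m, i ≤ (a : ℕ) → (a : ℕ) + 1 = b → (b : ℕ) < j → s a b) :
    SetConnected s (seg m i j) := by
  induction j, hij using Nat.le_induction with
  | base =>
    have : seg m i (i + 1) = {⟨i, hj⟩} := by ext w; simp [Fin.ext_iff]; omega
    exact this ▸ setConnected_singleton _
  | succ j hij ih =>
    have : seg m i (j + 1) = insert ⟨j, hj⟩ (seg m i j) := by
      ext w; simp [Fin.ext_iff]; omega
    rw [this]
    refine (ih (by omega) fun a b ha hab hb => h a b ha hab (by omega)).insert hs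
      (y := ⟨j - 1, by omega⟩) (by simp; omega) (hs _ _ (h _ _ ?_ ?_ ?_)) <;> simp <;> omega

/-- A value `t` missing between the minimum and the maximum would have to be jumped over by a pair
leaving the part below `t`, but related elements differ by one. -/
theorem exists_eq_seg {s : Fin m → Fin m → Prop} {I : Finset (Fin m)} (hI : SetConnected s I)
    (h : ∀ a ∈ I, ∀ b ∈ I, s a b → (a : ℕ) + 1 = b ∨ (b : ℕ) + 1 = a) :
    ∃ i j, i < j ∧ j ≤ m ∧ I = seg m i j := by
  obtain ⟨a, ha, hmin⟩ := exists_min_image I (fun v => (v : ℕ)) hI.1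
  obtain ⟨b, hb, hmax⟩ := exists_max_image I (fun v => (v : ℕ)) hI.1
  have hab := hmin b hb
  refine ⟨a, b + 1, by omega, b.2, Finset.ext fun t => ?_⟩
  rw [mem_seg]
  refine ⟨fun ht => ⟨hmin t ht, by have := hmax t ht; omega⟩, fun ht => ?_⟩
  by_contra htI
  have hta : (a : ℕ) ≠ t := fun e => htI (Fin.ext e ▸ ha)
  have htb : (b : ℕ) ≠ t := fun e => htI (Fin.ext e ▸ hb)
  obtain ⟨u, hu, v, hv, huv⟩ := hI.2 (I.filter fun v => (v : ℕ) < t)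
    (mem_powerset.2 (filter_subset _ _)) ⟨a, by simp [ha]; omega⟩
    (fun e => by have := (Finset.ext_iff.1 e b).2 hb; simp [hb] at this; omega)
  simp only [mem_filter, mem_sdiff, not_and, not_lt] at hu hv
  have hvt : (v : ℕ) ≠ t := fun e => htI (Fin.ext e ▸ hv.1)
  have := h u hu.1 v hv.1 huv
  have := hv.2 hv.1
  omega

end Segments

/-- The blocks of connected sets of the path: sets with the same largest element. -/
def pathBlocks (n : ℕ) (b : Fin n) : Set (Finset (Fin n)) :=
  {I | ∃ i ≤ (b : ℕ), I = seg n i (b + 1)}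

/-- Block `b` consists of the equations `s_{b+1} = s_i` with `i ≤ b`. A choice from all blocks
forces every `s_k` to equal `s_0 = 0`. -/
theorem niceBlocks_path (n : ℕ) :
    NiceBlocks (SimpleGraph.pathGraph n) (pathBlocks n) := by
  constructor
  · intro I
    constructor
    · intro hI
      obtain ⟨i, j, hij, hj, rfl⟩ := exists_eq_seg hI fun a _ b _ hab => by
        simpa [SimpleGraph.pathGraph_adj] using hab
      exact ⟨⟨j - 1, by omega⟩, i, by simp; omega, by simp; congr; omega⟩
    · rintro ⟨b, i, hi, rfl⟩
      refine setConnected_seg (fun a b h => h.symm) (by omega) b.2 fun a b _ hab _ => ?_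
      rw [SimpleGraph.pathGraph_adj]
      exact .inl hab
  · rintro b b' _ ⟨i, hi, rfl⟩ ⟨i', hi', h⟩
    have := seg_injective (by omega) b.2 (by omega) b'.2 h
    exact Fin.ext (by omega)
  · exact fun b => ⟨_, 0, by omega, rfl⟩
  · intro K hK x hx
    have hzero : ∀ k ≤ n, ∑ v ∈ seg n 0 k, x v = 0 := by
      intro k
      induction k using Nat.strong_induction_on with
      | _ k ih =>
        intro hk
        rcases Nat.eq_zero_or_pos k with rfl | hk0
        · exact sum_seg_zero x
        obtain ⟨i, hi, hKi⟩ := hK ⟨k - 1, by omega⟩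
        have := hx ⟨k - 1, by omega⟩
        simp only at hi hKi
        rw [hKi, Nat.sub_add_cancel hk0, sum_seg (by omega), ih i (by omega) (by omega)] at this
        simpa using this
    ext v
    rw [eq_sub_sum_seg x v, hzero _ v.2, hzero _ v.2.le]
    simp
  · intro X hX
    have hex : ∃ k, ∃ hk : k < n, ∃ I ∈ pathBlocks n ⟨k, hk⟩, ∀ x ∈ X, ∑ v ∈ I, x v = 0 := by
      obtain ⟨b, hb⟩ := hX
      exact ⟨b, b.2, hb⟩
    classical
    obtain ⟨hk, I, hI, hIX⟩ := Nat.find_spec hex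
    have hmin := fun k => Nat.find_min (m := k) hex
    set k := Nat.find hex
    refine ⟨⟨k, hk⟩, I, hI, hIX, ?_⟩
    obtain ⟨i, hi, rfl⟩ := hI
    rintro _ ⟨i', hi', rfl⟩ hJX
    simp only at hi hi' hIX hJX ⊢
    -- In the least block `k` met by the flat, two equations `s_{k+1} = s_a` and `s_{k+1} = s_b`
    -- would give `s_b = s_a`, which belongs to the earlier block `b - 1`.
    have hlt : ∀ a b, a < b → b ≤ k → (∀ x ∈ X, ∑ v ∈ seg n a (k + 1), x v = 0) →
        ¬ ∀ x ∈ X, ∑ v ∈ seg n b (k + 1), x v = 0 := by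
      intro a b hab hbk ha hb
      refine hmin (b - 1) (by omega) ⟨by omega, seg n a b, ⟨a, by simp; omega, ?_⟩, fun x hx => ?_⟩
      · simp only; congr; omega
      · have h1 := ha x hx
        have h2 := hb x hx
        rw [sum_seg (by omega)] at h1 h2 ⊢
        linarith
    rcases lt_trichotomy i i' with h | h | h
    · exact absurd hJX (hlt i i' h hi' hIX)
    · rw [h]
    · exact absurd hIX (hlt i' i h hi hJX)

/-! ### The nice partition for `Δ_{n,1}` -/

section Triangle

variable {n : ℕ}

/-- The elements `i, …, j - 1` together with the last element of `Fin (n + 1)`. -/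
def apexSeg (n i j : ℕ) : Finset (Fin (n + 1)) := insert (Fin.last n) (seg (n + 1) i j)

theorem mem_apexSeg {i j : ℕ} {v : Fin (n + 1)} :
    v ∈ apexSeg n i j ↔ (v : ℕ) = n ∨ i ≤ (v : ℕ) ∧ (v : ℕ) < j := by
  simp [apexSeg, Fin.ext_iff]

/-- The blocks of connected sets of `Δ_{n,1}`. -/
def triangleBlocks (n b : ℕ) : Set (Finset (Fin (n + 1))) :=
  {I | (b = 0 ∧ I = apexSeg n 0 1) ∨
    (b = 1 ∧ (I = apexSeg n 0 0 ∨ ∃ j, 1 ≤ j ∧ j ≤ n ∧ I = seg (n + 1) 0 j)) ∨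
    (2 ≤ b ∧ ((∃ i, 1 ≤ i ∧ i < b ∧ I = seg (n + 1) i b) ∨ I = apexSeg n 0 b ∨ I = apexSeg n 1 b))}

/-- With `W` minus the apex coordinate, block `0` is `s_1 = W`, block `1` is `W = 0` or `s_j = 0`,
and block `b ≥ 2` asks `s_b` to equal some `s_i` with `1 ≤ i < b`, or `W`, or `s_1 + W`. -/
theorem sum_apexSeg {i j : ℕ} (hij : i ≤ j) (hj : j ≤ n) (x : Fin (n + 1) → ℚ) :
    ∑ v ∈ apexSeg n i j, x v =
      x (Fin.last n) + (∑ v ∈ seg (n + 1) 0 j, x v - ∑ v ∈ seg (n + 1) 0 i, x v) := by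
  rw [apexSeg, sum_insert (by simp; omega), sum_seg hij]

theorem setConnected_seg_triangle (hn : 2 ≤ n) {i j : ℕ} (hij : i < j) (hj : j ≤ n) :
    SetConnected (pathWithTriangle n 1).Adj (seg (n + 1) i j) :=
  setConnected_seg (fun a b h => h.symm) hij (by omega) fun a b _ hab hb => by
    rw [pathWithTriangle_adj_iff hn, triangleRel]; omega

theorem setConnected_apexSeg (hn : 2 ≤ n) {i j : ℕ} (hi : i ≤ 1) (hij : i < j) (hj : j ≤ n) :
    SetConnected (pathWithTriangle n 1).Adj (apexSeg n i j) :=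
  (setConnected_seg_triangle hn hij hj).insert (fun a b h => h.symm) (y := ⟨i, by omega⟩)
    (by simp [hij]) (by rw [pathWithTriangle_adj_iff hn, triangleRel]; simp; omega)

theorem apexSeg_zero_zero : apexSeg n 0 0 = {Fin.last n} := by
  ext v; simp [mem_apexSeg, Fin.ext_iff]

theorem setConnected_of_mem_triangleBlocks (hn : 2 ≤ n) {b : ℕ} (hb : b ≤ n)
    {I : Finset (Fin (n + 1))} (hI : I ∈ triangleBlocks n b) :
    SetConnected (pathWithTriangle n 1).Adj I := by
  rcases hI with ⟨-, rfl⟩ | ⟨-, rfl | ⟨j, hj, hjn, rfl⟩⟩ | ⟨hb2, ⟨i, hi, hib, rfl⟩ | rfl | rfl⟩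
  · exact setConnected_apexSeg hn (by omega) (by omega) (by omega)
  · exact apexSeg_zero_zero ▸ setConnected_singleton _
  · exact setConnected_seg_triangle hn (by omega) hjn
  · exact setConnected_seg_triangle hn hib hb
  · exact setConnected_apexSeg hn (by omega) (by omega) hb
  · exact setConnected_apexSeg hn (by omega) (by omega) hb

/-- A connected set avoiding the apex is a segment. One containing it, besides the apex alone, is
completed by a segment starting at `0` or `1`, because the apex sees only these two vertices. -/
theorem exists_mem_triangleBlocks (hn : 2 ≤ n) {I : Finset (Fin (n + 1))}
    (hI : SetConnected (pathWithTriangle n 1).Adj I) : ∃ b ≤ n, I ∈ triangleBlocks n b := by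
  by_cases hl : Fin.last n ∈ I
  · rcases (I.erase (Fin.last n)).eq_empty_or_nonempty with h0 | hne
    · refine ⟨1, by omega, .inr (.inl ⟨rfl, .inl ?_⟩)⟩
      rw [apexSeg_zero_zero]
      exact ((subset_singleton_iff'.2 fun v hv => by
        by_contra hvl
        exact notMem_empty v (h0 ▸ mem_erase.2 ⟨hvl, hv⟩)).antisymm (singleton_subset_iff.2 hl))
    obtain ⟨b, hb, hmax⟩ := exists_max_image (I.erase (Fin.last n)) (fun v => (v : ℕ)) hne
    rw [mem_erase, ne_eq, Fin.ext_iff, Fin.val_last] at hb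
    have hbn : (b : ℕ) < n := by omega
    have hmax' : ∀ v ∈ I, (v : ℕ) ≠ n → (v : ℕ) ≤ b := fun v hv hvn =>
      hmax v (mem_erase.2 ⟨fun e => hvn (by simp [e]), hv⟩)
    -- The elements of `I` beyond `t` on the path are at least `2`, hence not adjacent to the apex;
    -- they can be joined to the rest only through `t`.
    have hfull : ∀ t : Fin (n + 1), 1 ≤ (t : ℕ) → (t : ℕ) ≤ b → t ∈ I := by
      intro t ht htb
      by_contra htI
      have htb' : (b : ℕ) ≠ t := fun e => htI (Fin.ext e ▸ hb.2)
      obtain ⟨u, hu, v, hv, huv⟩ := hI.2 (I.filter fun v => (t : ℕ) < v ∧ (v : ℕ) < n)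
        (mem_powerset.2 (filter_subset _ _)) ⟨b, by simp [hb]; omega⟩
        (fun e => by have := (Finset.ext_iff.1 e _).2 hl; simp at this)
      simp only [mem_filter, mem_sdiff, not_and, not_lt] at hu hv
      have hvt : (v : ℕ) ≠ t := fun e => htI (Fin.ext e ▸ hv.1)
      rw [pathWithTriangle_adj_iff hn, triangleRel] at huv
      have := hv.2 hv.1
      omega
    have hIeq : ∀ i, (∀ t : Fin (n + 1), (t : ℕ) < n → t ∈ I → i ≤ (t : ℕ)) →
        (∀ t : Fin (n + 1), i ≤ (t : ℕ) → (t : ℕ) ≤ b → t ∈ I) → I = apexSeg n i (b + 1) := by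
      intro i h1 h2
      ext t
      rw [mem_apexSeg]
      constructor
      · intro ht
        by_cases htn : (t : ℕ) = n
        · exact .inl htn
        · have := hmax' t ht htn
          exact .inr ⟨h1 t (by omega) ht, by omega⟩
      · rintro (ht | ht)
        · rwa [show t = Fin.last n from Fin.ext ht]
        · exact h2 t ht.1 (by omega)
    by_cases h0 : (0 : Fin (n + 1)) ∈ I
    · have heq := hIeq 0 (fun _ _ _ => Nat.zero_le _) fun t _ htb => by
        rcases Nat.eq_zero_or_pos (t : ℕ) with ht | ht
        · rwa [show t = 0 from Fin.ext ht]
        · exact hfull t ht htb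
      rcases Nat.eq_zero_or_pos (b : ℕ) with hb0 | hb0
      · exact ⟨0, by omega, .inl ⟨rfl, by rw [heq, hb0]⟩⟩
      · exact ⟨b + 1, by omega, .inr (.inr ⟨by omega, .inr (.inl heq)⟩)⟩
    · have hpos : ∀ t ∈ I, 1 ≤ (t : ℕ) := fun t ht => by
        by_contra hlt
        exact h0 ((Fin.ext (by rw [Fin.val_zero]; omega) : t = 0) ▸ ht)
      have hb0 := hpos b hb.2
      exact ⟨b + 1, by omega, .inr (.inr ⟨by omega, .inr (.inr (hIeq 1 (fun t _ => hpos t) hfull))⟩)⟩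
  · have hlt : ∀ a ∈ I, (a : ℕ) ≠ n := fun a ha e =>
      hl ((Fin.ext e : a = Fin.last n) ▸ ha)
    obtain ⟨i, j, hij, hj, rfl⟩ := exists_eq_seg hI fun a ha b hb hab => by
      rw [pathWithTriangle_adj_iff hn, triangleRel] at hab
      have := hlt a ha
      have := hlt b hb
      omega
    have hjn : j ≤ n := by
      by_contra hjn
      exact hl (by simp; omega)
    rcases Nat.eq_zero_or_pos i with rfl | hi
    · exact ⟨1, by omega, .inr (.inl ⟨rfl, .inr ⟨j, hij, hjn, rfl⟩⟩)⟩
    · exact ⟨j, hjn, .inr (.inr ⟨by omega, .inl ⟨i, hi, hij, rfl⟩⟩)⟩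

/-- The prescribed blocks are obtained by removing earlier candidates, so the explicit blocks agree
with them once each set fails all earlier conditions. -/
theorem triangleBlockCondition_of_mem (hn : 2 ≤ n) {b : Fin (n + 1)}
    {I : Finset (Fin (n + 1))} (hI : I ∈ triangleBlocks n b) :
    triangleBlockCondition n b I ∧ ∀ c < b, ¬ triangleBlockCondition n c I := by
  have h01 : apexSeg n 0 1 = {0, Fin.last n} := by
    ext v
    simp only [mem_apexSeg, mem_insert, mem_singleton, Fin.ext_iff, Fin.val_last, Fin.val_zero]
    omega
  have hb := b.2
  rcases hI with ⟨hb0, rfl⟩ | ⟨hb1, hI⟩ | ⟨hb2, hI⟩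
  · refine ⟨by rw [triangleBlockCondition, if_pos (by omega), h01], fun c hc => ?_⟩
    rw [Fin.lt_def] at hc
    omega
  · refine ⟨?_, fun c hc => ?_⟩
    · rw [triangleBlockCondition, if_neg (by omega), if_pos (by omega)]
      rcases hI with rfl | ⟨j, hj, hjn, rfl⟩
      · exact .inl apexSeg_zero_zero
      · refine .inr ⟨j, hj, hjn, ?_⟩
        ext v; simp
    · rw [Fin.lt_def] at hc
      rw [triangleBlockCondition, if_pos (by omega), ← h01]
      intro h
      have h0 := Finset.ext_iff.1 h 0
      have hl := Finset.ext_iff.1 h (Fin.last n)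
      rcases hI with rfl | ⟨j, hj, hjn, rfl⟩
      · simp [mem_apexSeg] at h0; omega
      · simp [mem_apexSeg] at hl; omega
  -- The vertex with label `b` rules out the avoidance condition of every earlier block from index
  -- `2` on.
  · have hmemlast : (⟨(b : ℕ) - 1, by omega⟩ : Fin (n + 1)) ∈ I := by
      rcases hI with ⟨i, hi, hib, rfl⟩ | rfl | rfl <;>
        simp only [mem_apexSeg, mem_seg] <;> omega
    refine ⟨?_, fun c hc h => ?_⟩
    · rw [triangleBlockCondition, if_neg (by omega), if_neg (by omega)]
      intro v hv
      rcases hI with ⟨i, hi, hib, rfl⟩ | rfl | rfl <;> simp [mem_apexSeg] at hv ⊢ <;> omega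
    rw [Fin.lt_def] at hc
    rw [triangleBlockCondition] at h
    split_ifs at h with h1 h2
    · rw [← h01] at h
      subst h
      simp [mem_apexSeg] at hmemlast
      omega
    · rcases h with h | ⟨k, hk, hkn, h⟩
      · subst h
        simp [Fin.ext_iff] at hmemlast
        omega
      · have h0 := Finset.ext_iff.1 h 0
        have hl := Finset.ext_iff.1 h (Fin.last n)
        rcases hI with ⟨i, hi, hib, rfl⟩ | rfl | rfl
        · simp at h0; omega
        · simp [mem_apexSeg] at hl; omega
        · simp [mem_apexSeg] at hl; omega
    · have := h _ hmemlast
      simp only at this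
      omega

theorem triangleBlocks_disjoint (hn : 2 ≤ n) {b c : Fin (n + 1)} {I : Finset (Fin (n + 1))}
    (hb : I ∈ triangleBlocks n b) (hc : I ∈ triangleBlocks n c) : b = c := by
  have h1 := triangleBlockCondition_of_mem hn hb
  have h2 := triangleBlockCondition_of_mem hn hc
  rcases lt_trichotomy b c with h | h | h
  · exact absurd h1.1 (h2.2 b h)
  · exact h
  · exact absurd h2.1 (h1.2 c h)

theorem mem_triangleCandidates_iff {b : Fin (n + 1)} {I : Finset (Fin (n + 1))} :
    hyperplane ℚ I ∈ triangleCandidates n b ↔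
      SetConnected (pathWithTriangle n 1).Adj I ∧ triangleBlockCondition n b I := by
  rw [setConnected_adj_iff]
  constructor
  · rintro ⟨J, h1, h2, h3, h4⟩
    rw [hyperplane_injective h4]
    exact ⟨⟨h1, h2⟩, h3⟩
  · rintro ⟨⟨h1, h2⟩, h3⟩
    exact ⟨I, h1, h2, h3, rfl⟩

theorem trianglePartition_eq (hn : 2 ≤ n) :
    trianglePartition n = fun b : Fin (n + 1) => hyperplane ℚ '' triangleBlocks n b := by
  ext b H
  simp only [trianglePartition, Set.mem_sdiff, Set.mem_iUnion, Subtype.exists, not_exists,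
    Set.mem_image]
  constructor
  · rintro ⟨hH, hc⟩
    obtain ⟨I, -, -, -, rfl⟩ := id hH
    rw [mem_triangleCandidates_iff] at hH
    obtain ⟨c, hcn, hI⟩ := exists_mem_triangleBlocks hn hH.1
    have hmem := triangleBlockCondition_of_mem hn (b := ⟨c, by omega⟩) hI
    refine ⟨I, ?_, rfl⟩
    rcases lt_trichotomy (⟨c, by omega⟩ : Fin (n + 1)) b with h | h | h
    · exact absurd (mem_triangleCandidates_iff.2 ⟨hH.1, hmem.1⟩) (hc _ h)
    · exact h ▸ hI
    · exact absurd hH.2 (hmem.2 b h)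
  · rintro ⟨I, hI, rfl⟩
    have hconn := setConnected_of_mem_triangleBlocks hn (by omega) hI
    have hmem := triangleBlockCondition_of_mem hn hI
    exact ⟨mem_triangleCandidates_iff.2 ⟨hconn, hmem.1⟩, fun c hc h =>
      hmem.2 c hc (mem_triangleCandidates_iff.1 h).2⟩

/-- For any flat, described by the values `U` of the partial sums and `W` of minus the apex
coordinate, some block contains exactly one set of the flat. -/
theorem exists_unique_mem_triangleBlocks (hn : 2 ≤ n) {A : Type*} [AddCommGroup A] (U : ℕ → A)
    (W : A) (hU : U 0 = 0) (Z : Finset (Fin (n + 1)) → Prop)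
    (hseg : ∀ i j, i ≤ j → j ≤ n → (Z (seg (n + 1) i j) ↔ U j = U i))
    (hapex : ∀ i j, i ≤ j → j ≤ n → (Z (apexSeg n i j) ↔ U j = U i + W))
    (hZ : ∃ b ≤ n, ∃ I ∈ triangleBlocks n b, Z I) :
    ∃ b ≤ n, ∃ I ∈ triangleBlocks n b, Z I ∧ ∀ J ∈ triangleBlocks n b, Z J → J = I := by
  classical
  by_cases h1W : U 1 = W
  · refine ⟨0, by omega, _, .inl ⟨rfl, rfl⟩, (hapex 0 1 (by omega) (by omega)).2 (by simp [*]), ?_⟩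
    rintro J (⟨-, rfl⟩ | ⟨h, -⟩ | ⟨h, -⟩) -
    exacts [rfl, by omega, by omega]
  -- Exactly one of the two can vanish, as `U 1 ≠ W`. The least `k ≥ 2` with `U k = 0` gives the
  -- block; if there is none, block `1` works.
  by_cases hdeg : W = 0 ∨ U 1 = 0
  · by_cases hk : ∃ k, 2 ≤ k ∧ k ≤ n ∧ U k = 0
    · obtain ⟨hk2, hkn, hk0⟩ := Nat.find_spec hk
      have hmin : ∀ i, 1 ≤ i → i < Nat.find hk → U i = 0 → i = 1 := fun i hi hik hi0 => by
        by_contra hne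
        exact Nat.find_min hk hik ⟨by omega, by omega, hi0⟩
      set k := Nat.find hk
      rcases hdeg with hW | h1
      · have h10 : U 1 ≠ 0 := fun h => h1W (h.trans hW.symm)
        refine ⟨k, hkn, _, .inr (.inr ⟨hk2, .inr (.inl rfl)⟩),
          (hapex 0 k (by omega) hkn).2 (by simp [*]), ?_⟩
        rintro J (⟨h, -⟩ | ⟨h, -⟩ | ⟨-, ⟨i, hi, hik, rfl⟩ | rfl | rfl⟩) hJ
        · omega
        · omega
        · rw [hseg i k hik.le hkn, hk0, eq_comm] at hJ
          exact absurd (hmin i hi hik hJ ▸ hJ) h10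
        · rfl
        · rw [hapex 1 k (by omega) hkn, hk0, hW, add_zero, eq_comm] at hJ
          exact absurd hJ h10
      · have hW : W ≠ 0 := fun h => h1W (h1.trans h.symm)
        refine ⟨k, hkn, _, .inr (.inr ⟨hk2, .inl ⟨1, by omega, by omega, rfl⟩⟩),
          (hseg 1 k (by omega) hkn).2 (by simp [*]), ?_⟩
        rintro J (⟨h, -⟩ | ⟨h, -⟩ | ⟨-, ⟨i, hi, hik, rfl⟩ | rfl | rfl⟩) hJ
        · omega
        · omega
        · rw [hseg i k hik.le hkn, hk0, eq_comm] at hJ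
          rw [hmin i hi hik hJ]
        · rw [hapex 0 k (by omega) hkn, hk0, hU, zero_add, eq_comm] at hJ
          exact absurd hJ hW
        · rw [hapex 1 k (by omega) hkn, hk0, h1, zero_add, eq_comm] at hJ
          exact absurd hJ hW
    · push Not at hk
      rcases hdeg with hW | h1
      · have h10 : U 1 ≠ 0 := fun h => h1W (h.trans hW.symm)
        refine ⟨1, by omega, _, .inr (.inl ⟨rfl, .inl rfl⟩),
          (hapex 0 0 (by omega) (by omega)).2 (by simp [*]), ?_⟩
        rintro J (⟨h, -⟩ | ⟨-, rfl | ⟨j, hj, hjn, rfl⟩⟩ | ⟨h, -⟩) hJ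
        · omega
        · rfl
        · rw [hseg 0 j (by omega) hjn, hU] at hJ
          rcases hj.eq_or_lt with rfl | hj
          · exact absurd hJ h10
          · exact absurd hJ (hk j hj hjn)
        · omega
      · have hW : W ≠ 0 := fun h => h1W (h1.trans h.symm)
        refine ⟨1, by omega, _, .inr (.inl ⟨rfl, .inr ⟨1, le_rfl, by omega, rfl⟩⟩),
          (hseg 0 1 (by omega) (by omega)).2 (by simp [*]), ?_⟩
        rintro J (⟨h, -⟩ | ⟨-, rfl | ⟨j, hj, hjn, rfl⟩⟩ | ⟨h, -⟩) hJ
        · omega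
        · rw [hapex 0 0 le_rfl (by omega), hU, zero_add, eq_comm] at hJ
          exact absurd hJ hW
        · rw [hseg 0 j (by omega) hjn, hU] at hJ
          rcases hj.eq_or_lt with rfl | hj
          · rfl
          · exact absurd hJ (hk j hj hjn)
        · omega
  push Not at hdeg
  obtain ⟨hW, h10⟩ := hdeg
  -- For the least such `k`, the values `U 1, …, U (k - 1)`, `W`, `U 1 + W` are pairwise distinct,
  -- by minimality and nondegeneracy, so `U k` matches only one.
  by_cases hk : ∃ k, 2 ≤ k ∧ k ≤ n ∧ ∃ I ∈ triangleBlocks n k, Z I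
  · obtain ⟨hk2, hkn, I, hI, hIZ⟩ := Nat.find_spec hk
    have hmin : ∀ i, 2 ≤ i → i < Nat.find hk → ∀ I ∈ triangleBlocks n i, ¬ Z I :=
      fun i hi hik I hI hZI => Nat.find_min hk hik ⟨hi, by omega, I, hI, hZI⟩
    set k := Nat.find hk
    have hss : ∀ i j, 1 ≤ i → i < j → j < k → U j ≠ U i := fun i j hi hij hjk h =>
      hmin j (by omega) hjk _ (.inr (.inr ⟨by omega, .inl ⟨i, hi, hij, rfl⟩⟩))
        ((hseg i j hij.le (by omega)).2 h)
    have hs0 : ∀ i, 1 ≤ i → i < k → U i ≠ W := fun i hi hik h => by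
      rcases hi.eq_or_lt with rfl | hi
      · exact h1W h
      · exact hmin i hi hik _ (.inr (.inr ⟨hi, .inr (.inl rfl)⟩))
          ((hapex 0 i (by omega) (by omega)).2 (by rw [hU, zero_add, h]))
    have hs1 : ∀ i, 1 ≤ i → i < k → U i ≠ U 1 + W := fun i hi hik h => by
      rcases hi.eq_or_lt with rfl | hi
      · exact hW (left_eq_add.1 h)
      · exact hmin i hi hik _ (.inr (.inr ⟨hi, .inr (.inr rfl)⟩))
          ((hapex 1 i (by omega) (by omega)).2 h)
    have h01 : W ≠ U 1 + W := fun h => h10 (right_eq_add.1 h)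
    have hval : ∀ I ∈ triangleBlocks n k, Z I →
        (∃ i, 1 ≤ i ∧ i < k ∧ I = seg (n + 1) i k ∧ U k = U i) ∨ (I = apexSeg n 0 k ∧ U k = W) ∨
          (I = apexSeg n 1 k ∧ U k = U 1 + W) := by
      rintro J (⟨h, -⟩ | ⟨h, -⟩ | ⟨-, ⟨i, hi, hik, rfl⟩ | rfl | rfl⟩) hJ
      · omega
      · omega
      · exact .inl ⟨i, hi, hik, rfl, (hseg i k hik.le hkn).1 hJ⟩
      · exact .inr (.inl ⟨rfl, by simpa [hU] using (hapex 0 k (by omega) hkn).1 hJ⟩)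
      · exact .inr (.inr ⟨rfl, (hapex 1 k (by omega) hkn).1 hJ⟩)
    refine ⟨k, hkn, I, hI, hIZ, fun J hJ hJZ => ?_⟩
    rcases hval I hI hIZ with ⟨i, hi, hik, rfl, h⟩ | ⟨rfl, h⟩ | ⟨rfl, h⟩ <;>
      rcases hval J hJ hJZ with ⟨j, hj, hjk, rfl, h'⟩ | ⟨rfl, h'⟩ | ⟨rfl, h'⟩
    · rcases lt_trichotomy i j with hij | hij | hij
      · exact absurd (h'.symm.trans h) (hss i j hi hij hjk)
      · rw [hij]
      · exact absurd (h.symm.trans h') (hss j i hj hij hik)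
    · exact absurd (h.symm.trans h') (hs0 i hi hik)
    · exact absurd (h.symm.trans h') (hs1 i hi hik)
    · exact absurd (h'.symm.trans h) (hs0 j hj hjk)
    · rfl
    · exact absurd (h.symm.trans h') h01
    · exact absurd (h'.symm.trans h) (hs1 j hj hjk)
    · exact absurd (h'.symm.trans h) h01
    · rfl
  -- Only block `1` remains, through equations `U j = 0` with `j ≥ 2`; two of them would give `U i =
  -- U j`, which belongs to a block excluded here.
  · push Not at hk
    have hval : ∀ I ∈ triangleBlocks n 1, Z I →
        ∃ j, 2 ≤ j ∧ j ≤ n ∧ I = seg (n + 1) 0 j ∧ U j = 0 := by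
      rintro J (⟨h, -⟩ | ⟨-, rfl | ⟨j, hj, hjn, rfl⟩⟩ | ⟨h, -⟩) hJ
      · omega
      · rw [hapex 0 0 le_rfl (by omega), hU, zero_add, eq_comm] at hJ
        exact absurd hJ hW
      · rw [hseg 0 j (by omega) hjn, hU] at hJ
        rcases hj.eq_or_lt with rfl | hj
        · exact absurd hJ h10
        · exact ⟨j, hj, hjn, rfl, hJ⟩
      · omega
    have hss : ∀ i j, 2 ≤ i → i < j → j ≤ n → U j ≠ U i := fun i j hi hij hjn h =>
      hk j (by omega) hjn _ (.inr (.inr ⟨by omega, .inl ⟨i, by omega, hij, rfl⟩⟩))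
        ((hseg i j hij.le hjn).2 h)
    obtain ⟨b, hbn, I, hI, hIZ⟩ := hZ
    have hb1 : b = 1 := by
      rcases id hI with ⟨-, rfl⟩ | ⟨h, -⟩ | ⟨h, -⟩
      · rw [hapex 0 1 (by omega) (by omega), hU, zero_add] at hIZ
        exact absurd hIZ h1W
      · exact h
      · exact absurd hIZ (hk b h hbn I hI)
    subst hb1
    refine ⟨1, hbn, I, hI, hIZ, fun J hJ hJZ => ?_⟩
    obtain ⟨i, hi, hin, rfl, h⟩ := hval I hI hIZ
    obtain ⟨j, hj, hjn, rfl, h'⟩ := hval J hJ hJZ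
    rcases lt_trichotomy i j with hij | hij | hij
    · exact absurd (h'.trans h.symm) (hss i j hi hij hjn)
    · rw [hij]
    · exact absurd (h.trans h'.symm) (hss j i hj hij hin)

theorem niceBlocks_pathWithTriangle (hn : 2 ≤ n) :
    NiceBlocks (pathWithTriangle n 1) fun b : Fin (n + 1) => triangleBlocks n b := by
  constructor
  · intro I
    constructor
    · intro hI
      obtain ⟨b, hb, hI⟩ := exists_mem_triangleBlocks hn hI
      exact ⟨⟨b, by omega⟩, hI⟩
    · rintro ⟨b, hI⟩
      exact setConnected_of_mem_triangleBlocks hn (by omega) hI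
  · exact fun b c I => triangleBlocks_disjoint hn
  · intro b
    rcases Nat.lt_or_ge b 2 with hb | hb
    · rcases Nat.lt_or_ge b 1 with hb' | hb'
      · exact ⟨_, .inl ⟨by omega, rfl⟩⟩
      · exact ⟨_, .inr (.inl ⟨by omega, .inl rfl⟩)⟩
    · exact ⟨_, .inr (.inr ⟨hb, .inr (.inl rfl)⟩)⟩
  · intro K hK x hx
    set s : ℕ → ℚ := fun k => ∑ v ∈ seg (n + 1) 0 k, x v with hs
    have hs0 : s 0 = 0 := sum_seg_zero x
    have hseg : ∀ i j, i ≤ j → ∑ v ∈ seg (n + 1) i j, x v = s j - s i := fun i j hij =>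
      sum_seg hij x
    have hapex : ∀ i j, i ≤ j → j ≤ n →
        ∑ v ∈ apexSeg n i j, x v = x (Fin.last n) + (s j - s i) := fun i j hij hj =>
      sum_apexSeg hij hj x
    have h0 : x (Fin.last n) + s 1 = 0 := by
      have := hx ⟨0, by omega⟩
      rcases hK ⟨0, by omega⟩ with ⟨-, h⟩ | ⟨h, -⟩ | ⟨h, -⟩
      · rw [h, hapex 0 1 (by omega) (by omega), hs0] at this
        linarith
      · simp at h
      · simp at h
    -- The choice in block `0` sets `W = s 1`, so the alternatives `W` and `s 1 + W` become `s 1`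
    -- and `2 * s 1`.
    have hval : ∀ k, 1 ≤ k → k ≤ n → s k = s 1 ∨ s k = 2 * s 1 := by
      intro k
      induction k using Nat.strong_induction_on with
      | _ k ih =>
        intro hk hkn
        rcases hk.eq_or_lt with rfl | hk
        · exact .inl rfl
        have := hx ⟨k, by omega⟩
        rcases hK ⟨k, by omega⟩ with ⟨h, -⟩ | ⟨h, -⟩ | ⟨-, ⟨i, hi, hik, h⟩ | h | h⟩
        · simp only at h; omega
        · simp only at h; omega
        · simp only at hik h
          rw [h, hseg i k hik.le] at this
          rw [show s k = s i by linarith]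
          exact ih i hik hi (by omega)
        · rw [h, hapex 0 k (by omega) hkn, hs0] at this
          exact .inl (by linarith)
        · rw [h, hapex 1 k (by omega) hkn] at this
          exact .inr (by linarith)
    -- The choice in block `1` kills `W` or some `s j`, each of which is `s 1` or `2 * s 1`.
    have h1 : s 1 = 0 := by
      have := hx ⟨1, by omega⟩
      rcases hK ⟨1, by omega⟩ with ⟨h, -⟩ | ⟨-, h | ⟨j, hj, hjn, h⟩⟩ | ⟨h, -⟩
      · simp at h
      · rw [h, hapex 0 0 le_rfl (by omega)] at this
        linarith
      · rw [h, hseg 0 j (by omega), hs0] at this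
        rcases hval j hj hjn with h' | h' <;> linarith
      · simp at h
    have hzero : ∀ k ≤ n, s k = 0 := fun k hk => by
      rcases Nat.eq_zero_or_pos k with rfl | hk0
      · exact hs0
      · rcases hval k hk0 hk with h | h <;> simp [h, h1]
    ext v
    rcases eq_or_ne v (Fin.last n) with rfl | hv
    · simp; linarith
    · have hvn : (v : ℕ) < n := Fin.lt_last_iff_ne_last.2 hv
      have := eq_sub_sum_seg x v
      have h2 := hzero (v + 1) hvn
      have h3 := hzero v hvn.le
      simp only [hs] at h2 h3
      rw [this, h2, h3]
      simp
  · rintro X ⟨b, hb⟩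
    -- An equation holding on all of `X` is an equality of functions `X → ℚ`, so the case analysis
    -- takes place in that group.
    obtain ⟨b, hbn, h⟩ := exists_unique_mem_triangleBlocks hn (A := X → ℚ)
      (fun k x => ∑ v ∈ seg (n + 1) 0 k, x.1 v) (fun x => -x.1 (Fin.last n))
      (funext fun x => sum_seg_zero x.1) (fun I => ∀ x ∈ X, ∑ v ∈ I, x v = 0)
      (fun i j hij hj => by
        simp only [sum_seg hij, funext_iff, Subtype.forall, sub_eq_zero])
      (fun i j hij hj => by
        simp only [sum_apexSeg hij hj, funext_iff, Subtype.forall, Pi.add_apply]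
        refine forall₂_congr fun x hx => ⟨fun h => by linarith, fun h => by linarith⟩)
      ⟨b, by omega, hb⟩
    exact ⟨⟨b, by omega⟩, h⟩

end Triangle

theorem isNicePartition_trianglePartition {n : ℕ} (hn : 2 ≤ n) :
    IsNicePartition (arrangement ℚ (pathWithTriangle n 1)) (trianglePartition n) :=
  trianglePartition_eq hn ▸ (niceBlocks_pathWithTriangle hn).isNicePartition rfl

theorem isFactored_of_iso {M N : Type*} [DecidableEq M] [Fintype N] {G : SimpleGraph N}
    {H : SimpleGraph M} (e : G ≃g H) {s : ℕ} {B : Fin s → Set (Finset M)} (h : NiceBlocks H B)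
    (hs : s = Fintype.card N) : IsFactored (arrangement ℚ G) := by
  classical
  exact ⟨s, _, (h.comap e.toEquiv fun _ _ => e.map_adj_iff).isNicePartition
    ((Fintype.card_fin s).trans hs)⟩

end ConnectedSubgraph

theorem mainTheorem6 :
    (∀ {N : Type*} [Fintype N] (G : SimpleGraph N), G.Connected →
      (HyperplaneArrangement.IsFactored (ConnectedSubgraph.arrangement ℚ G) ↔
        (∃ n : ℕ, Nonempty (G ≃g SimpleGraph.pathGraph n)) ∨
        (∃ n : ℕ, 2 ≤ n ∧ Nonempty (G ≃g ConnectedSubgraph.pathWithTriangle n 1)))) ∧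
    (∀ n : ℕ, 2 ≤ n →
      HyperplaneArrangement.IsNicePartition
        (ConnectedSubgraph.arrangement ℚ (ConnectedSubgraph.pathWithTriangle n 1))
        (ConnectedSubgraph.trianglePartition n)) := by
  refine ⟨fun {N} _ G hG => ⟨ConnectedSubgraph.isoClass_of_isFactored hG, ?_⟩,
    fun n hn => ConnectedSubgraph.isNicePartition_trianglePartition hn⟩
  rintro (⟨n, ⟨e⟩⟩ | ⟨n, hn, ⟨e⟩⟩)
  · exact ConnectedSubgraph.isFactored_of_iso e (ConnectedSubgraph.niceBlocks_path n)
      (by simpa using (Fintype.card_congr e.toEquiv).symm)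
  · exact ConnectedSubgraph.isFactored_of_iso e (ConnectedSubgraph.niceBlocks_pathWithTriangle hn)
      (by simpa using (Fintype.card_congr e.toEquiv).symm)
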